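/- Let $K$ be a field of characteristic $0$ and $V$ a finite-dimensional vector space over $K$. The decomposable envelope of a Lie subalgebra $\mathfrak g$ of $\mathfrak{gl}_K(V)$ is the Lie subalgebra of $\mathfrak{gl}_K(V)$ generated by the semisimple and nilpotent Jordan--Chevalley components of the elements of $\mathfrak g$, and $\mathfrak g$ is called decomposable (in $V$) if it equals its decomposable envelope. Let $\mathfrak n_V$ denote the ideal of $\mathfrak g$ consisting of those elements of the solvable radical of $\mathfrak g$ that are nilpotent endomorphisms of $V$. A $V$-reductive Levi factor of $\mathfrak g$ is a Lie subalgebra $\mathfrak l_V\subseteq\mathfrak g$ such that $V$ is a completely reducible $\mathfrak l_V$-module and $\mathfrak g=\mathfrak l_V\oplus\mathfrak n_V$ as vector spaces. **Proposition.** Let $\mathfrak g$ be a decomposable Lie subalgebra of $\mathfrak{gl}_K(V)$ and let $\mathfrak t$ be a commutative Lie subalgebra of $\mathfrak g$ consisting of semisimple endomorphisms of $V$. Then $\mathfrak g$ has a $V$-reductive Levi factor $\mathfrak l_V$ that contains $\mathfrak t$. -/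

import Mathlib

attribute [local instance 100] LieRing.ofAssociativeRing

/-- The decomposable envelope of a Lie subalgebra `g` of `gl(V)`: the Lie subalgebra of `gl(V)`
generated by the semisimple and nilpotent Jordan-Chevalley components of the elements of `g`. -/
def decomposableEnvelope {K V : Type*} [Field K] [AddCommGroup V] [Module K V]
    (g : LieSubalgebra K (Module.End K V)) : LieSubalgebra K (Module.End K V) :=
  LieSubalgebra.lieSpan K (Module.End K V)
    {B | ∃ A ∈ g, ∃ S N : Module.End K V, S.IsSemisimple ∧ IsNilpotent N ∧ ⁅S, N⁆ = 0 ∧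
      A = S + N ∧ (B = S ∨ B = N)}

/-- `g` is decomposable in `V` when it is equal to its decomposable envelope. -/
def IsDecomposable {K V : Type*} [Field K] [AddCommGroup V] [Module K V]
    (g : LieSubalgebra K (Module.End K V)) : Prop :=
  decomposableEnvelope g = g

/-- `l` is `V`-reductive when the `l`-module `V` is completely reducible: every `l`-submodule
of `V` has a complementary `l`-submodule. -/
def IsVReductive {K V : Type*} [Field K] [AddCommGroup V] [Module K V]
    (l : LieSubalgebra K (Module.End K V)) : Prop :=
  ComplementedLattice (LieSubmodule K l V)

/-- `n` is the ideal `n_V` of `g`: its elements are exactly the elements of the solvable radical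
of `g` that are nilpotent endomorphisms of `V`. -/
def IsNilpotencyIdeal {K V : Type*} [Field K] [AddCommGroup V] [Module K V]
    (g : LieSubalgebra K (Module.End K V)) (n : LieIdeal K g) : Prop :=
  ∀ X : g, X ∈ n ↔ X ∈ LieAlgebra.radical K g ∧ IsNilpotent (X : Module.End K V)

/-- `l` is a `V`-reductive Levi factor of `g`: a `V`-reductive Lie subalgebra of `g` such that
`g = l ⊕ n_V` as vector spaces (a Levi-Chevalley decomposition of `g` in `V`). -/
structure IsVReductiveLeviFactor {K V : Type*} [Field K] [AddCommGroup V] [Module K V]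
    (g l : LieSubalgebra K (Module.End K V)) : Prop where
  le : l ≤ g
  reductive : IsVReductive l
  direct_sum : ∃ n : LieIdeal K g, IsNilpotencyIdeal g n ∧
    IsCompl (l.toSubmodule.comap g.toSubmodule.subtype) n.toSubmodule

/-! Enlarge `t` to a maximal subspace `T` of commuting semisimple elements of `g`, and let `n` be
the set of nilpotent elements of the radical. By Lie's theorem over the algebraic closure, `n` is an
ideal containing `[g, rad g]`. An equivariant form of Levi's theorem gives a complement `s` of the
radical normalized by `T`. The required factor is `l = s + (T ∩ rad g)`, and `T ∩ rad g` centralizes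
`s` because `[T ∩ rad g, s]` lies in `s ∩ rad g = 0`.

Three facts make `l` work. (1) `rad g = n + (T ∩ rad g)`. Since `ad T` is semisimple and sends the
radical into `n`, each element of the radical is congruent modulo `n` to one commuting with `T`.
Decomposability puts the Jordan components of the latter in `g`; the semisimple one lies in the
radical, and in `T` by maximality. (2) `T ⊆ l`. Write `x = y + z` with `y` in `s` and `z` in the
radical. Then `z` centralizes `s`, so `ad x` and `ad y` agree on `s`, and the nilpotent part of `y`
commutes with `s`. Complete reducibility of `V` over `s` kills it; hence `y` and `z` are semisimple
and `z` lies in `T`. (3) `V` is completely reducible over `l`, by Weyl's theorem for `s` combined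
with semisimplicity of the commuting operators in `T ∩ rad g`.

The Levi and Weyl statements rest on two devices: a Casimir argument that corrects an element to an
invariant one, and `exists_sub_forall_apply_eq_zero`, which makes the correction compatible with a
commuting semisimple family. -/

/-! ### Casimir endomorphisms and Weyl's theorem -/

namespace LieModule

open Module LieAlgebra

variable {K L M : Type*} [Field K] [LieRing L] [LieAlgebra K L]
  [AddCommGroup M] [Module K M] [LieRingModule L M] [LieModule K L M]

/-- A nilpotent module over a perfect Lie algebra is trivial. -/
theorem lie_eq_zero_of_isNilpotent_of_perfect [LieModule.IsNilpotent L M]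
    (hL : ⁅(⊤ : LieIdeal K L), (⊤ : LieIdeal K L)⁆ = ⊤) (x : L) (m : M) : ⁅x, m⁆ = 0 := by
  have h2 : ∀ u v : L, ∀ n : M, ⁅u, ⁅v, n⁆⁆ ∈ ⁅(⊤ : LieIdeal K L), ⁅(⊤ : LieIdeal K L),
      (⊤ : LieSubmodule K L M)⁆⁆ := fun u v n =>
    LieSubmodule.lie_mem_lie (by simp) (LieSubmodule.lie_mem_lie (by simp) (by simp))
  have h1 : ∀ a ∈ ⁅(⊤ : LieIdeal K L), (⊤ : LieIdeal K L)⁆, ∀ n : M,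
      ⁅a, n⁆ ∈ ⁅(⊤ : LieIdeal K L), ⁅(⊤ : LieIdeal K L), (⊤ : LieSubmodule K L M)⁆⁆ := by
    intro a ha n
    rw [← LieSubmodule.mem_toSubmodule, LieSubmodule.lieIdeal_oper_eq_linear_span'] at ha
    induction ha using Submodule.span_induction with
    | mem a ha =>
      obtain ⟨u, -, v, -, rfl⟩ := ha
      rw [lie_lie]
      exact sub_mem (h2 u v n) (h2 v u n)
    | zero => simp
    | add a b _ _ ha hb => rw [add_lie]; exact add_mem ha hb
    | smul c a _ ha => rw [smul_lie]; exact (LieSubmodule.toSubmodule _).smul_mem c ha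
  have step : ∀ k, lowerCentralSeries K L M (k + 1) = lowerCentralSeries K L M 1 := by
    intro k
    induction k with
    | zero => rfl
    | succ k ih =>
      rw [lowerCentralSeries_succ, ih]
      simp only [lowerCentralSeries_succ, lowerCentralSeries_zero]
      refine le_antisymm (LieSubmodule.mono_lie_right _ le_top) ?_
      conv_lhs => rw [LieSubmodule.lieIdeal_oper_eq_span]
      rw [LieSubmodule.lieSpan_le]
      rintro _ ⟨⟨a, ha⟩, ⟨n, -⟩, rfl⟩
      exact h1 a (by rw [hL]; exact LieSubmodule.mem_top a) n
  obtain ⟨k, hk⟩ := (LieModule.isNilpotent_iff K L M).mp inferInstance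
  have h0 : lowerCentralSeries K L M 1 = ⊥ := by
    rw [← step k, eq_bot_iff, ← hk]
    exact antitone_lowerCentralSeries K L M (Nat.le_succ k)
  have : ⁅x, m⁆ ∈ lowerCentralSeries K L M 1 := by
    rw [lowerCentralSeries_succ, lowerCentralSeries_zero]
    exact LieSubmodule.lie_mem_lie (by simp) (by simp)
  rwa [h0, LieSubmodule.mem_bot] at this

end LieModule

namespace LieAlgebra

/-- A Lie algebra with non-degenerate Killing form is perfect. -/
theorem IsKilling.lie_top_top (K L : Type*) [Field K] [LieRing L] [LieAlgebra K L]
    [Module.Finite K L] [IsKilling K L] :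
    ⁅(⊤ : LieIdeal K L), (⊤ : LieIdeal K L)⁆ = ⊤ := by
  have hc := LieIdeal.isCompl_killingCompl (K := K) (L := L) ⁅(⊤ : LieIdeal K L), (⊤ : LieIdeal K L)⁆
  suffices LieIdeal.killingCompl K L ⁅(⊤ : LieIdeal K L), (⊤ : LieIdeal K L)⁆ = ⊥ by
    rw [this] at hc
    simpa using hc.sup_eq_top
  rw [LieSubmodule.eq_bot_iff]
  intro x hx
  rw [LieIdeal.mem_killingCompl] at hx
  -- Invariance turns orthogonality to all brackets into orthogonality of `⁅y, x⁆` to everything;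
  -- the centre is zero.
  have hx0 : x ∈ center K L := by
    rw [LieModule.mem_maxTrivSubmodule]
    intro y
    refine (IsKilling.killingForm_nondegenerate K L).1 _ fun z => ?_
    have := hx ⁅z, y⁆ (LieSubmodule.lie_mem_lie (by simp) (by simp))
    rw [LieModule.traceForm_comm, ← LieModule.traceForm_apply_lie_apply, this]
  simpa using hx0

end LieAlgebra

namespace LieModule

open Module LieAlgebra

variable {K L M : Type*} [Field K] [LieRing L] [LieAlgebra K L]
  [AddCommGroup M] [Module K M] [LieRingModule L M] [LieModule K L M]

/-- A Casimir endomorphism of a module: it commutes with the action, has its image in every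
submodule containing `⁅L, M⁆`, and is nilpotent only if the action is trivial. -/
theorem exists_casimir [CharZero K] [Module.Finite K L] [IsKilling K L] [Module.Finite K M] :
    ∃ c : End K M, (∀ x : L, ∀ m, c ⁅x, m⁆ = ⁅x, c m⁆) ∧
      (∀ N : LieSubmodule K L M, (∀ x : L, ∀ m : M, ⁅x, m⁆ ∈ N) → ∀ m, c m ∈ N) ∧
      (_root_.IsNilpotent c → ∀ (x : L) (m : M), ⁅x, m⁆ = 0) := by
  set β := traceForm K L M with hβ
  -- The module need not be faithful, so the trace form may degenerate. Its kernel `I` is split off,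
  -- and the Casimir element is built from dual bases of the complementary ideal `J`, where the form
  -- is nondegenerate.
  let I : LieIdeal K L := InvariantForm.orthogonal β (traceForm_lieInvariant K L M) ⊤
  let J := LieIdeal.killingCompl K L I
  have hIJ : IsCompl I J := LieIdeal.isCompl_killingCompl I
  have hI : ∀ x, x ∈ I ↔ ∀ y, β y x = 0 := fun x => by
    simp [I, InvariantForm.mem_orthogonal]
  let B : LinearMap.BilinForm K J := β.restrict J.toSubmodule
  have hBapp : ∀ x y : J, B x y = β x y := fun x y => rfl
  have hsym : ∀ x y, β x y = β y x := traceForm_comm K L M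
  have hBs : B.IsSymm := ⟨fun x y => hsym x y⟩
  have hB : B.Nondegenerate := by
    refine hBs.isRefl.nondegenerate_iff_separatingLeft.mpr fun x hx => ?_
    have : (x : L) ∈ I ⊓ J := by
      refine ⟨(hI _).mpr fun y => ?_, x.2⟩
      have hy : y ∈ I ⊔ J := by rw [hIJ.sup_eq_top]; simp
      obtain ⟨i, hi, j, hj, rfl⟩ := (LieSubmodule.mem_sup _ _ _).mp hy
      rw [map_add, LinearMap.add_apply, hsym i, (hI i).mp hi, hsym j, zero_add]
      exact hx ⟨j, hj⟩
    rw [hIJ.inf_eq_bot] at this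
    simpa using this
  let b := Module.finBasis K J
  let b' := B.dualBasis hB b
  let ρ := toEnd K L M
  let c : End K M := ∑ i, ρ (b i) * ρ (b' i)
  have hc : ∀ m, c m = ∑ i, ⁅(b i : L), ⁅(b' i : L), m⁆⁆ := fun m => by
    simp [c, ρ, LinearMap.sum_apply]
  have e1 : ∀ z : J, z = ∑ j, B z (b' j) • b j := by
    intro z
    conv_lhs => rw [← b.sum_repr z]
    refine Finset.sum_congr rfl fun j _ => ?_
    congr 1
    conv_rhs => rw [← b.sum_repr z]
    simp only [map_sum, LinearMap.sum_apply, map_smul, LinearMap.smul_apply, b',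
      LinearMap.BilinForm.apply_dualBasis_right hB hBs]
    simp
  have e2 : ∀ z : J, z = ∑ j, B z (b j) • b' j := by
    intro z
    conv_lhs => rw [← b'.sum_repr z]
    simp [b', LinearMap.BilinForm.dualBasis_repr_apply]
  refine ⟨c, fun x m => ?_, fun N hN m => ?_, fun hnil => ?_⟩
  · have key : ∑ i, ⁅((⁅x, b i⁆ : J) : L), ⁅(b' i : L), m⁆⁆ +
        ∑ i, ⁅(b i : L), ⁅((⁅x, b' i⁆ : J) : L), m⁆⁆ = 0 := by
      have h1 : ∀ i, ⁅((⁅x, b i⁆ : J) : L), ⁅(b' i : L), m⁆⁆ =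
          ∑ j, B ⁅x, b i⁆ (b' j) • ⁅(b j : L), ⁅(b' i : L), m⁆⁆ := fun i => by
        conv_lhs => rw [e1 ⁅x, b i⁆]
        simp [sum_lie, smul_lie]
      have h2 : ∀ i, ⁅(b i : L), ⁅((⁅x, b' i⁆ : J) : L), m⁆⁆ =
          ∑ j, B ⁅x, b' i⁆ (b j) • ⁅(b i : L), ⁅(b' j : L), m⁆⁆ := fun i => by
        conv_lhs => rw [e2 ⁅x, b' i⁆]
        simp [sum_lie, smul_lie, lie_sum, lie_smul]
      rw [Finset.sum_congr rfl fun i _ => h1 i, Finset.sum_congr rfl fun i _ => h2 i]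
      rw [Finset.sum_comm, ← Finset.sum_add_distrib]
      refine Finset.sum_eq_zero fun i _ => ?_
      rw [← Finset.sum_add_distrib]
      refine Finset.sum_eq_zero fun j _ => ?_
      rw [← add_smul]
      have : B ⁅x, b j⁆ (b' i) + B ⁅x, b' i⁆ (b j) = 0 := by
        have := traceForm_lieInvariant K L M x (b j) (b' i)
        simp only [hBapp, LieSubmodule.coe_bracket]
        rw [← hβ] at this
        rw [this, hsym ⁅x, (b' i : L)⁆]
        simp
      rw [this, zero_smul]
    rw [hc, hc, lie_sum, ← sub_eq_zero, ← neg_eq_zero, neg_sub, ← Finset.sum_sub_distrib, ← key,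
      ← Finset.sum_add_distrib]
    refine Finset.sum_congr rfl fun i _ => ?_
    simp only [LieSubmodule.coe_bracket]
    rw [leibniz_lie x (b i : L), leibniz_lie x (b' i : L) m, lie_add]
    abel
  · rw [hc]
    exact sum_mem fun i _ => hN _ _
  -- Each dual pair contributes 1 to the trace. A nilpotent `c` thus forces `J = 0` in
  -- characteristic zero, so the trace form vanishes and the perfect algebra `L` acts nilpotently.
  · have htr : LinearMap.trace K M c = (Module.finrank K J : K) := by
      have : ∀ i, LinearMap.trace K M (ρ (b i) * ρ (b' i)) = 1 := fun i => by
        have := LinearMap.BilinForm.apply_dualBasis_right hB hBs b i i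
        rw [if_pos rfl, hBapp, hβ, traceForm_apply_apply] at this
        exact this
      simp [c, this]
    have h0 : LinearMap.trace K M c = 0 :=
      (LinearMap.isNilpotent_trace_of_isNilpotent hnil).eq_zero
    have hJ : Module.finrank K J = 0 := by
      rw [htr] at h0; exact_mod_cast h0
    have hJ' : J = ⊥ := by
      rw [← LieSubmodule.toSubmodule_eq_bot]
      exact Submodule.finrank_eq_zero.mp hJ
    have hItop : I = ⊤ := by have := hIJ.sup_eq_top; rwa [hJ', sup_bot_eq] at this
    have hβ0 : traceForm K L M = 0 := by
      ext x y
      exact (hI y).mp (hItop ▸ LieSubmodule.mem_top y) x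
    have hder : derivedSeries K L 1 = ⊤ := by
      rw [derivedSeries_def, derivedSeriesOfIdeal_succ, derivedSeriesOfIdeal_zero]
      exact IsKilling.lie_top_top K L
    have hn := isNilpotent_derivedSeries_of_traceForm_eq_zero hβ0
    have hn' : LieModule.IsNilpotent L M := by
      rw [isNilpotent_iff_forall' (R := K)] at hn ⊢
      intro x
      exact hn ⟨x, hder ▸ LieSubmodule.mem_top x⟩
    exact lie_eq_zero_of_isNilpotent_of_perfect (IsKilling.lie_top_top K L)

/-- Weyl's theorem for submodules containing `⁅L, M⁆`. -/
theorem exists_sub_invariant_of_isKilling [CharZero K] [Module.Finite K L] [IsKilling K L]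
    [Module.Finite K M] (N : LieSubmodule K L M) (hN : ∀ (x : L) (m : M), ⁅x, m⁆ ∈ N) (m : M) :
    ∃ n ∈ N, ∀ x : L, ⁅x, m - n⁆ = 0 := by
  induction hd : finrank K M using Nat.strong_induction_on generalizing M with
  | _ d ih =>
  obtain ⟨c, hcomm, hcN, hcnil⟩ := exists_casimir (K := K) (L := L) (M := M)
  obtain ⟨k, hk⟩ := Filter.eventually_atTop.mp (LinearMap.eventually_isCompl_ker_pow_range_pow c)
  -- Fitting decomposition. The exponent must be positive so that the range of the power lies in the
  -- range of `c`, hence in `N`; induction then handles the kernel.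
  have hcompl := hk (k + 1) (Nat.le_succ k)
  have hcomm' : ∀ (j : ℕ) (x : L) (m : M), (c ^ j) ⁅x, m⁆ = ⁅x, (c ^ j) m⁆ := by
    intro j
    induction j with
    | zero => simp
    | succ j ihj => intro x m; simp only [pow_succ', End.mul_apply, ihj, hcomm]
  let M₀ : LieSubmodule K L M :=
    { LinearMap.ker (c ^ (k + 1)) with
      lie_mem := fun {x m} hm => by
        simp only [AddSubsemigroup.mem_carrier, AddSubmonoid.mem_toSubsemigroup,
          Submodule.mem_toAddSubmonoid, LinearMap.mem_ker] at hm ⊢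
        rw [hcomm', hm, lie_zero] }
  by_cases htop : M₀ = ⊤
  · have hnil : _root_.IsNilpotent c := ⟨k + 1, by
      ext v
      have : v ∈ M₀ := htop ▸ LieSubmodule.mem_top v
      exact this⟩
    exact ⟨0, N.zero_mem, fun x => hcnil hnil _ _⟩
  · have hlt : finrank K M₀ < d := by
      rw [← hd]
      refine Submodule.finrank_lt (s := M₀.toSubmodule) ?_
      simpa using htop
    obtain ⟨a, ha, e, he, hae⟩ := Submodule.mem_sup.mp
      (show m ∈ LinearMap.ker (c ^ (k + 1)) ⊔ LinearMap.range (c ^ (k + 1)) by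
        rw [hcompl.sup_eq_top]; simp)
    obtain ⟨n, hn, hn'⟩ := ih _ hlt (M := M₀) (N.comap M₀.incl) (fun x m => hN _ _) ⟨a, ha⟩ rfl
    refine ⟨n + e, N.add_mem hn ?_, fun x => ?_⟩
    · obtain ⟨w, rfl⟩ := he
      rw [pow_succ', End.mul_apply]
      exact hcN N hN _
    · have := congrArg Subtype.val (hn' x)
      simp only [LieSubmodule.coe_bracket, LieSubmodule.coe_zero, LieSubmodule.coe_sub] at this
      rw [← hae, show a + e - ((n : M) + e) = a - n by abel]
      exact this

end LieModule

namespace LieModule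

open Module LieAlgebra

variable {K L S M : Type*} [Field K] [CharZero K] [LieRing L] [LieAlgebra K L]
  [LieRing S] [LieAlgebra K S] [Module.Finite K S] [HasTrivialRadical K S]
  [AddCommGroup M] [Module K M] [LieRingModule L M] [LieModule K L M]

/-- Weyl's theorem for modules on which the action factors through a semisimple quotient. -/
theorem exists_sub_invariant_of_surjective [Module.Finite K M] (f : L →ₗ⁅K⁆ S)
    (hf : Function.Surjective f) (hM : ∀ x, f x = 0 → ∀ m : M, ⁅x, m⁆ = 0)
    (N : LieSubmodule K L M) (hN : ∀ (x : L) (m : M), ⁅x, m⁆ ∈ N) (m : M) :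
    ∃ n ∈ N, ∀ x : L, ⁅x, m - n⁆ = 0 := by
  obtain ⟨h, hh⟩ := (f : L →ₗ[K] S).exists_rightInverse_of_surjective
    (LinearMap.range_eq_top.mpr hf)
  have hh' : ∀ s, f (h s) = s := fun s => LinearMap.congr_fun hh s
  have hker : ∀ x y : L, f x = f y → ∀ m : M, ⁅x, m⁆ = ⁅y, m⁆ := fun x y hxy m => by
    rw [← sub_eq_zero, ← sub_lie]
    exact hM _ (by rw [map_sub, hxy, sub_self]) m
  -- The linear section `h` respects brackets only modulo the kernel of `f`, which suffices because
  -- that kernel acts by zero.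
  let ρ : S →ₗ⁅K⁆ End K M :=
    { (toEnd K L M : L →ₗ[K] End K M) ∘ₗ h with
      map_lie' := fun {s t} => by
        ext m
        have := hker (h ⁅s, t⁆) ⁅h s, h t⁆ (by rw [LieHom.map_lie, hh', hh', hh']) m
        simpa using! this }
  have hρ : ∀ s m, ρ s m = ⁅h s, m⁆ := fun s m => rfl
  let _ : LieRingModule S M := LieRingModule.compLieHom M ρ
  let _ : LieModule K S M := LieModule.compLieHom M ρ
  have hS : ∀ (s : S) (m : M), ⁅s, m⁆ = ⁅h s, m⁆ := fun s m => rfl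
  let N' : LieSubmodule K S M := { N.toSubmodule with
    lie_mem := fun {s m} _ => hN (h s) m }
  obtain ⟨n, hn, hn'⟩ := exists_sub_invariant_of_isKilling N' (fun s m => hN (h s) m) m
  refine ⟨n, hn, fun x => ?_⟩
  rw [hker x (h (f x)) (hh' _).symm, ← hS]
  exact hn' _

/-- Weyl's theorem for a subquotient `C / A`. -/
theorem exists_sub_invariant_of_surjective_of_le [Module.Finite K M] (f : L →ₗ⁅K⁆ S)
    (hf : Function.Surjective f) (A B C : LieSubmodule K L M)
    (hA : ∀ x, f x = 0 → ∀ m ∈ C, ⁅x, m⁆ ∈ A)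
    (hB : ∀ (x : L), ∀ m ∈ C, ⁅x, m⁆ ∈ B) {m : M} (hm : m ∈ C) :
    ∃ n ∈ B, ∀ x : L, ⁅x, m - n⁆ ∈ A := by
  let A' : LieSubmodule K L C := A.comap C.incl
  let N : LieSubmodule K L (C ⧸ A') := (B.comap C.incl).map (LieSubmodule.Quotient.mk' A')
  have hmk : ∀ c : C, LieSubmodule.Quotient.mk' A' c = 0 ↔ (c : M) ∈ A := fun c => by
    exact (LieSubmodule.Quotient.mk_eq_zero' (N := A')).trans Iff.rfl
  have hsurj := LieSubmodule.Quotient.surjective_mk' A'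
  obtain ⟨n, hn, hn'⟩ := exists_sub_invariant_of_surjective (M := C ⧸ A') f hf
    (fun x hx m => by
      obtain ⟨c, rfl⟩ := hsurj m
      rw [← LieModuleHom.map_lie, hmk]
      exact hA x hx c c.2) N
    (fun x m => by
      obtain ⟨c, rfl⟩ := hsurj m
      rw [← LieModuleHom.map_lie]
      exact LieSubmodule.mem_map_of_mem (hB x c c.2))
    (LieSubmodule.Quotient.mk' A' ⟨m, hm⟩)
  obtain ⟨b, hb, rfl⟩ := (LieSubmodule.mem_map _).mp hn
  refine ⟨b, hb, fun x => ?_⟩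
  have := hn' x
  rw [← map_sub, ← LieModuleHom.map_lie, hmk] at this
  exact this

end LieModule

/-! ### Commuting semisimple endomorphisms -/

namespace Module.End

variable {K E : Type*} [Field K] [AddCommGroup E] [Module K E]

/-- A semisimple endomorphism decomposes each of its invariant subspaces as image plus kernel. -/
theorem IsSemisimple.exists_sub_mem_ker [FiniteDimensional K E] {f : End K E}
    (hf : f.IsSemisimple) {D : Submodule K E}
    (hD : ∀ d ∈ D, f d ∈ D) {d : E} (hd : d ∈ D) : ∃ e ∈ D, f (d - f e) = 0 := by
  let g : End K D := f.restrict hD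
  have hg : g.IsSemisimple := hf.restrict (p := D) hD
  obtain ⟨q, hq, hc⟩ := isSemisimple_iff.mp hg (LinearMap.ker g) (by
    rw [Module.End.mem_invtSubmodule]
    intro x hx
    simp only [Submodule.mem_comap, LinearMap.mem_ker] at hx ⊢
    rw [hx, map_zero])
  have hq' : ∀ x ∈ q, g x ∈ q := fun x hx => hq hx
  obtain ⟨a, ha, b, hb, hab⟩ := Submodule.mem_sup.mp
    (show (⟨d, hd⟩ : D) ∈ LinearMap.ker g ⊔ q by rw [hc.sup_eq_top]; simp)
  let k : End K q := g.restrict hq'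
  have hk : Function.Injective k := (injective_iff_map_eq_zero k).mpr fun x hx => by
    have hx' : (x : D) ∈ LinearMap.ker g := congrArg Subtype.val hx
    exact Subtype.ext ((Submodule.mem_bot K).mp (hc.inf_eq_bot ▸ ⟨hx', x.2⟩))
  obtain ⟨e, he⟩ := (LinearMap.injective_iff_surjective.mp hk) ⟨b, hb⟩
  have he' : f (e : D) = b := congrArg (fun x : q => ((x : D) : E)) he
  refine ⟨e, (e : D).2, ?_⟩
  have hd' : d = a + b := (congrArg Subtype.val hab).symm
  rw [he', hd', add_sub_cancel_right]
  exact congrArg Subtype.val ha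

/-- If commuting semisimple endomorphisms map an invariant subspace `D` to `D₀`, then every
element of `D` is modulo `D₀` killed by all of them. -/
theorem exists_sub_forall_apply_eq_zero [FiniteDimensional K E] (T : Set (End K E))
    (hT : ∀ f ∈ T, f.IsSemisimple) (hcomm : ∀ f ∈ T, ∀ g ∈ T, Commute f g)
    (D D₀ : Submodule K E) (hD : ∀ f ∈ T, ∀ d ∈ D, f d ∈ D) (hD₀ : ∀ f ∈ T, ∀ d ∈ D, f d ∈ D₀)
    {d : E} (hd : d ∈ D) : ∃ e ∈ D, d - e ∈ D₀ ∧ ∀ f ∈ T, f e = 0 := by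
  -- Take a minimal invariant subspace that still covers `D` modulo `D₀`. If some `f` in `T` did not
  -- kill it, intersecting with the kernel of `f` would give a smaller one: image plus kernel is
  -- everything, and the image lies in `D₀`. Minimality allows `T` to be infinite.
  let P : Set (Submodule K E) :=
    {D' | D' ≤ D ∧ (∀ f ∈ T, ∀ d ∈ D', f d ∈ D') ∧ ∀ d ∈ D, ∃ e ∈ D', d - e ∈ D₀}
  obtain ⟨D', ⟨hle, hinv, hsup⟩, hmin⟩ := wellFounded_lt.has_min P
    ⟨D, le_rfl, hD, fun d hd => ⟨d, hd, by simp⟩⟩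
  obtain ⟨e, he, hde⟩ := hsup d hd
  refine ⟨e, hle he, hde, fun f hf => ?_⟩
  by_contra hne
  refine hmin (D' ⊓ LinearMap.ker f) ⟨inf_le_left.trans hle, fun g hg x hx => ⟨hinv g hg x hx.1, ?_⟩,
    fun y hy => ?_⟩ (lt_of_le_of_ne inf_le_left fun h => hne ?_)
  · have hx2 : f x = 0 := hx.2
    have : f (g x) = g (f x) := LinearMap.congr_fun (hcomm f hf g hg).eq x
    simp [this, hx2]
  · obtain ⟨a, ha, hya⟩ := hsup y hy
    obtain ⟨b, hb, hab⟩ := (hT f hf).exists_sub_mem_ker (hinv f hf) ha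
    refine ⟨a - f b, ⟨sub_mem ha (hinv f hf b hb), hab⟩, ?_⟩
    rw [show y - (a - f b) = (y - a) + f b by abel]
    exact add_mem hya (hD₀ f hf b (hle hb))
  · exact (h.ge he).2

end Module.End

/-! ### Lie's theorem and the nilpotent elements of a solvable ideal -/

namespace LieModule

open Module LieAlgebra
open scoped TensorProduct

section

variable {K L M : Type*} [Field K] [LieRing L] [LieAlgebra K L]
  [AddCommGroup M] [Module K M] [LieRingModule L M] [LieModule K L M]

theorem mk'_toEnd_pow (N : LieSubmodule K L M) (x : L) (k : ℕ) (m : M) :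
    LieSubmodule.Quotient.mk' N ((toEnd K L M x ^ k) m) =
      (toEnd K L (M ⧸ N) x ^ k) (LieSubmodule.Quotient.mk' N m) := by
  induction k with
  | zero => rfl
  | succ k ih =>
    rw [pow_succ', pow_succ', End.mul_apply, End.mul_apply, ← ih, toEnd_apply_apply,
      toEnd_apply_apply, LieModuleHom.map_lie]

theorem isNilpotent_toEnd_quotient (N : LieSubmodule K L M) {x : L}
    (h : _root_.IsNilpotent (toEnd K L M x)) : _root_.IsNilpotent (toEnd K L (M ⧸ N) x) := by
  obtain ⟨k, hk⟩ := h
  refine ⟨k, LinearMap.ext fun m => ?_⟩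
  obtain ⟨m, rfl⟩ := LieSubmodule.Quotient.surjective_mk' N m
  rw [← mk'_toEnd_pow, hk]
  simp

theorem isNilpotent_toEnd_of_quotient (N : LieSubmodule K L M) {x : L}
    (hN : ∀ m ∈ N, ⁅x, m⁆ = 0) (h : _root_.IsNilpotent (toEnd K L (M ⧸ N) x)) :
    _root_.IsNilpotent (toEnd K L M x) := by
  obtain ⟨k, hk⟩ := h
  refine ⟨k + 1, LinearMap.ext fun m => ?_⟩
  rw [pow_succ', End.mul_apply, toEnd_apply_apply]
  refine hN _ ?_
  have := mk'_toEnd_pow N x k m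
  rw [hk, LinearMap.zero_apply] at this
  exact (LieSubmodule.Quotient.mk_eq_zero' (N := N)).mp this

end

section

variable {K L : Type*} [Field K] [CharZero K] [LieRing L] [LieAlgebra K L]

/-- By Lie's theorem `I` has a nonzero weight space `N`, stable under all of `L` in characteristic
zero. Elements of `I` act on `N` by scalars, so brackets `⁅y, x⁆` vanish there, and nilpotent
elements of `I` have weight zero. Induction on dimension treats `M ⧸ N`. -/
theorem isNilpotent_toEnd_of_isAlgClosed [IsAlgClosed K] (I : LieIdeal K L) [IsSolvable I]
    (M : Type*) [AddCommGroup M] [Module K M] [LieRingModule L M] [LieModule K L M]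
    [Module.Finite K M] :
    (∀ y : L, ∀ x ∈ I, _root_.IsNilpotent (toEnd K L M ⁅y, x⁆)) ∧
    (∀ x ∈ I, ∀ y ∈ I, _root_.IsNilpotent (toEnd K L M x) → _root_.IsNilpotent (toEnd K L M y) →
      _root_.IsNilpotent (toEnd K L M (x + y))) := by
  induction hd : finrank K M using Nat.strong_induction_on generalizing M with
  | _ d ih =>
  obtain hM | hM := subsingleton_or_nontrivial M
  · exact ⟨fun y x _ => ⟨1, Subsingleton.elim _ _⟩, fun x _ y _ _ _ => ⟨1, Subsingleton.elim _ _⟩⟩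
  obtain ⟨χ, hχ⟩ : ∃ χ : Module.Dual K I, Nontrivial (weightSpace M χ) :=
    exists_nontrivial_weightSpace_of_isSolvable K I M
  let N : LieSubmodule K L M := weightSpaceOfIsLieTower K M χ
  have hN : ∀ (x : L) (hx : x ∈ I), ∀ m ∈ N, ⁅x, m⁆ = χ ⟨x, hx⟩ • m := fun x hx m hm => by
    have : m ∈ weightSpace M χ := hm
    rw [mem_weightSpace] at this
    exact this ⟨x, hx⟩
  obtain ⟨⟨v, hv⟩, hv0⟩ := exists_ne (0 : weightSpace M χ)
  have hv0' : v ≠ 0 := fun h => hv0 (Subtype.ext h)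
  have hlt : finrank K (M ⧸ N) < d := by
    rw [← hd]
    have hpos : 0 < finrank K N :=
      Module.finrank_pos_iff_exists_ne_zero.mpr ⟨⟨v, hv⟩, fun h => hv0' (congrArg Subtype.val h)⟩
    have := Submodule.finrank_quotient_add_finrank N.toSubmodule
    change finrank K (M ⧸ N) + finrank K N = _ at this
    lia
  obtain ⟨ih₁, ih₂⟩ := ih _ hlt (M ⧸ N) rfl
  have hnil : ∀ (x : L) (hx : x ∈ I), _root_.IsNilpotent (toEnd K L M x) →
      ∀ m ∈ N, ⁅x, m⁆ = 0 := by
    rintro x hx ⟨k, hk⟩ m hm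
    have hpow : ∀ j, (toEnd K L M x ^ j) v = χ ⟨x, hx⟩ ^ j • v := by
      intro j
      induction j with
      | zero => simp
      | succ j ihj => rw [pow_succ', End.mul_apply, ihj, map_smul, toEnd_apply_apply, hN x hx v hv,
          smul_smul, pow_succ]
    have h0 := hpow k
    rw [hk, LinearMap.zero_apply, eq_comm, smul_eq_zero] at h0
    rw [hN x hx m hm, eq_zero_of_pow_eq_zero (h0.resolve_right hv0'), zero_smul]
  refine ⟨fun y x hx => ?_, fun x hx y hy hxn hyn => ?_⟩
  · refine isNilpotent_toEnd_of_quotient N (fun m hm => ?_) (ih₁ y x hx)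
    rw [lie_lie, hN x hx m hm, hN x hx _ (N.lie_mem hm), lie_smul, sub_self]
  · refine isNilpotent_toEnd_of_quotient N (fun m hm => ?_)
      (ih₂ x hx y hy (isNilpotent_toEnd_quotient N hxn) (isNilpotent_toEnd_quotient N hyn))
    rw [add_lie, hnil x hx hxn m hm, hnil y hy hyn m hm, add_zero]

/-- The elements of a solvable ideal `I` acting nilpotently form an ideal, which
contains `⁅L, I⁆`. -/
theorem exists_nilpotency_ideal (I : LieIdeal K L) [IsSolvable I]
    (M : Type*) [AddCommGroup M] [Module K M] [LieRingModule L M] [LieModule K L M]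
    [Module.Finite K M] :
    ∃ n : LieIdeal K L, (∀ x, x ∈ n ↔ x ∈ I ∧ _root_.IsNilpotent (toEnd K L M x)) ∧
      ∀ y : L, ∀ x ∈ I, ⁅y, x⁆ ∈ n := by
  -- Weights exist only after scalar extension; nilpotency is unaffected because base change is
  -- injective on endomorphisms.
  let A := AlgebraicClosure K
  have hsol : IsSolvable (I.baseChange A) := by
    obtain ⟨k, hk⟩ := IsSolvable.solvable K I
    rw [LieIdeal.derivedSeries_eq_bot_iff] at hk
    refine IsSolvable.mk (R := A) (k := k) ?_
    rw [LieIdeal.derivedSeries_eq_bot_iff, derivedSeriesOfIdeal_baseChange, hk,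
      LieSubmodule.baseChange_bot]
  have hinj : Function.Injective (End.baseChangeHom K A M) := LinearMap.baseChangeHom_injective K M A
  have hnil : ∀ x : L, _root_.IsNilpotent (toEnd K L M x) ↔
      _root_.IsNilpotent (toEnd A (A ⊗[K] L) (A ⊗[K] M) (1 ⊗ₜ[K] x)) := fun x => by
    rw [toEnd_baseChange, ← IsNilpotent.map_iff hinj]
    rfl
  obtain ⟨h₁, h₂⟩ := isNilpotent_toEnd_of_isAlgClosed (I.baseChange A) (A ⊗[K] M)
  have hI : ∀ x ∈ I, 1 ⊗ₜ[K] x ∈ I.baseChange A := fun x hx =>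
    LieSubmodule.tmul_mem_baseChange_of_mem 1 hx
  have h₃ : ∀ y : L, ∀ x ∈ I, _root_.IsNilpotent (toEnd K L M ⁅y, x⁆) := fun y x hx => by
    have := h₁ (1 ⊗ₜ y) _ (hI x hx)
    rwa [LieAlgebra.ExtendScalars.bracket_tmul, mul_one, ← hnil] at this
  refine ⟨{ carrier := {x | x ∈ I ∧ _root_.IsNilpotent (toEnd K L M x)}
            zero_mem' := ⟨I.zero_mem, by simp⟩
            add_mem' := fun {x y} hx hy => ⟨I.add_mem hx.1 hy.1, ?_⟩
            smul_mem' := fun c x hx => ⟨I.smul_mem c hx.1, by rw [map_smul]; exact hx.2.smul c⟩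
            lie_mem := fun {y x} hx => ⟨I.lie_mem hx.1, h₃ y x hx.1⟩ },
    fun x => Iff.rfl, fun y x hx => ⟨I.lie_mem hx, h₃ y x hx⟩⟩
  have := h₂ _ (hI x hx.1) _ (hI y hy.1) ((hnil x).mp hx.2) ((hnil y).mp hy.2)
  rwa [← TensorProduct.tmul_add, ← hnil] at this

end

end LieModule

/-! ### The semisimple quotient by the radical -/

namespace LieAlgebra

variable {K L : Type*} [Field K] [LieRing L] [LieAlgebra K L]

variable (K L) in
/-- The projection to the quotient by the radical. -/
def radicalQuotientHom : L →ₗ⁅K⁆ L ⧸ radical K L :=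
  { (LieSubmodule.Quotient.mk' (radical K L) : L →ₗ[K] L ⧸ radical K L) with
    map_lie' := fun {_ _} => rfl }

theorem radicalQuotientHom_surjective : Function.Surjective (radicalQuotientHom K L) :=
  LieSubmodule.Quotient.surjective_mk' (radical K L)

theorem radicalQuotientHom_eq_zero {x : L} : radicalQuotientHom K L x = 0 ↔ x ∈ radical K L :=
  LieSubmodule.Quotient.mk_eq_zero' (N := radical K L)

variable [Module.Finite K L]

/-- The preimage of a solvable ideal is an extension of it by the radical, so it is solvable and
lies in the radical. -/
instance hasTrivialRadical_quotient_radical : HasTrivialRadical K (L ⧸ radical K L) := by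
  refine hasTrivialRadical_of_no_solvable_ideals (fun J hJ => ?_)
  let f := radicalQuotientHom K L
  let J' : LieIdeal K L := J.comap f
  have hmap : ∀ k, ∀ x ∈ derivedSeriesOfIdeal K L k J',
      f x ∈ derivedSeriesOfIdeal K (L ⧸ radical K L) k J := by
    intro k
    induction k with
    | zero => intro x hx; exact hx
    | succ k ih =>
      intro x hx
      rw [derivedSeriesOfIdeal_succ, ← LieSubmodule.mem_toSubmodule,
        LieSubmodule.lieIdeal_oper_eq_linear_span'] at hx
      rw [derivedSeriesOfIdeal_succ]
      induction hx using Submodule.span_induction with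
      | mem a ha =>
        obtain ⟨u, hu, v, hv, rfl⟩ := ha
        rw [LieHom.map_lie]
        exact LieSubmodule.lie_mem_lie (ih u hu) (ih v hv)
      | zero => simp
      | add a b _ _ ha hb => rw [map_add]; exact add_mem ha hb
      | smul c a _ ha => rw [map_smul]; exact (LieSubmodule.toSubmodule _).smul_mem c ha
  obtain ⟨k, hk⟩ := IsSolvable.solvable K J
  obtain ⟨m, hm⟩ := IsSolvable.solvable K (radical K L)
  rw [LieIdeal.derivedSeries_eq_bot_iff] at hk hm
  have hle : derivedSeriesOfIdeal K L k J' ≤ radical K L := fun x hx => by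
    have := hmap k x hx
    rw [hk, LieSubmodule.mem_bot] at this
    exact radicalQuotientHom_eq_zero.mp this
  have hJ' : IsSolvable J' := IsSolvable.mk (R := K) (k := m + k) (by
    rw [LieIdeal.derivedSeries_eq_bot_iff, derivedSeriesOfIdeal_add, eq_bot_iff, ← hm]
    exact derivedSeriesOfIdeal_mono hle m)
  rw [LieIdeal.solvable_iff_le_radical] at hJ'
  rw [LieSubmodule.eq_bot_iff]
  intro y hy
  obtain ⟨x, rfl⟩ := radicalQuotientHom_surjective y
  exact radicalQuotientHom_eq_zero.mpr (hJ' hy)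

/-- An element central modulo the radical lies in the radical. -/
theorem mem_radical_of_forall_lie_mem {x : L} (h : ∀ y : L, ⁅y, x⁆ ∈ radical K L) :
    x ∈ radical K L := by
  rw [← radicalQuotientHom_eq_zero]
  have : radicalQuotientHom K L x ∈ center K (L ⧸ radical K L) := by
    rw [LieModule.mem_maxTrivSubmodule]
    intro y
    obtain ⟨y, rfl⟩ := radicalQuotientHom_surjective y
    rw [← LieHom.map_lie, radicalQuotientHom_eq_zero]
    exact h y
  simpa using this

theorem lie_top_sup_radical [CharZero K] :
    ⁅(⊤ : LieIdeal K L), (⊤ : LieIdeal K L)⁆ ⊔ radical K L = ⊤ := by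
  rw [eq_top_iff]
  intro x _
  have key : ∀ z ∈ ⁅(⊤ : LieIdeal K (L ⧸ radical K L)), (⊤ : LieIdeal K (L ⧸ radical K L))⁆,
      ∃ y ∈ ⁅(⊤ : LieIdeal K L), (⊤ : LieIdeal K L)⁆, radicalQuotientHom K L y = z := by
    intro z hz
    rw [← LieSubmodule.mem_toSubmodule, LieSubmodule.lieIdeal_oper_eq_linear_span'] at hz
    induction hz using Submodule.span_induction with
    | mem a ha =>
      obtain ⟨u, -, v, -, rfl⟩ := ha
      obtain ⟨u, rfl⟩ := radicalQuotientHom_surjective u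
      obtain ⟨v, rfl⟩ := radicalQuotientHom_surjective v
      exact ⟨⁅u, v⁆, LieSubmodule.lie_mem_lie (by simp) (by simp), LieHom.map_lie _ _ _⟩
    | zero => exact ⟨0, by simp, by simp⟩
    | add a b _ _ ha hb =>
      obtain ⟨a, ha, rfl⟩ := ha
      obtain ⟨b, hb, rfl⟩ := hb
      exact ⟨a + b, add_mem ha hb, map_add _ _ _⟩
    | smul c a _ ha =>
      obtain ⟨a, ha, rfl⟩ := ha
      exact ⟨c • a, (LieSubmodule.toSubmodule _).smul_mem c ha, map_smul _ _ _⟩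
  obtain ⟨y, hy, hyx⟩ := key (radicalQuotientHom K L x) (by
    rw [IsKilling.lie_top_top]; exact LieSubmodule.mem_top _)
  rw [LieSubmodule.mem_sup]
  refine ⟨y, hy, x - y, ?_, add_sub_cancel _ _⟩
  rw [← radicalQuotientHom_eq_zero, map_sub, hyx, sub_self]

end LieAlgebra

/-! ### Levi's theorem, equivariantly -/

namespace LieAlgebra

open Module LieModule

variable {K L : Type*} [Field K] [LieRing L] [LieAlgebra K L]

/-- The endomorphisms of `L` mapping the subspace `p` to the subspace `q`. -/
def mapsToSubmodule (p q : Submodule K L) : Submodule K (L →ₗ[K] L) where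
  carrier := {φ | ∀ v ∈ p, φ v ∈ q}
  zero_mem' := fun _ _ => q.zero_mem
  add_mem' := fun hφ hψ v hv => q.add_mem (hφ v hv) (hψ v hv)
  smul_mem' := fun c _ hφ v hv => q.smul_mem c (hφ v hv)

theorem lie_mem_mapsToSubmodule {p q : Submodule K L} {x : L} (hp : ∀ v ∈ p, ⁅x, v⁆ ∈ p)
    (hq : ∀ v ∈ q, ⁅x, v⁆ ∈ q) {φ : L →ₗ[K] L} (hφ : φ ∈ mapsToSubmodule p q) :
    ⁅x, φ⁆ ∈ mapsToSubmodule p q := fun v hv => by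
  rw [LieHom.lie_apply]
  exact sub_mem (hq _ (hφ v hv)) (hφ _ (hp v hv))

/-- The span of the brackets of elements of two subspaces. -/
def lieSpanSubmodule (p q : Submodule K L) : Submodule K L :=
  Submodule.span K {z | ∃ a ∈ p, ∃ b ∈ q, ⁅a, b⁆ = z}

theorem lie_mem_lieSpanSubmodule {p q : Submodule K L} {a b : L} (ha : a ∈ p) (hb : b ∈ q) :
    ⁅a, b⁆ ∈ lieSpanSubmodule p q :=
  Submodule.subset_span ⟨a, ha, b, hb, rfl⟩

theorem lieSpanSubmodule_le {p q m : Submodule K L} (h : ∀ a ∈ p, ∀ b ∈ q, ⁅a, b⁆ ∈ m) :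
    lieSpanSubmodule p q ≤ m :=
  Submodule.span_le.mpr (by rintro _ ⟨a, ha, b, hb, rfl⟩; exact h a ha b hb)

theorem lie_lieSpanSubmodule_mem {p q : Submodule K L} {x : L} (hp : ∀ v ∈ p, ⁅x, v⁆ ∈ p)
    (hq : ∀ v ∈ q, ⁅x, v⁆ ∈ q) {v : L} (hv : v ∈ lieSpanSubmodule p q) :
    ⁅x, v⁆ ∈ lieSpanSubmodule p q := by
  suffices lieSpanSubmodule p q ≤ (lieSpanSubmodule p q).comap (ad K L x) from this hv
  refine lieSpanSubmodule_le fun a ha b hb => ?_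
  rw [Submodule.mem_comap, ad_apply, leibniz_lie]
  exact add_mem (lie_mem_lieSpanSubmodule (hp a ha) hb) (lie_mem_lieSpanSubmodule ha (hq b hb))

theorem isSemisimple_toEnd_linearMap [PerfectField K] [Module.Finite K L] {x : L}
    (hx : (ad K L x).IsSemisimple) : (toEnd K L (L →ₗ[K] L) x).IsSemisimple := by
  have h := ad_isSemisimple_of_isSemisimple (K := K) hx
  have : toEnd K L (L →ₗ[K] L) x = ad K (End K L) (ad K L x) := by
    ext φ v
    simp [LieHom.lie_apply, Ring.lie_def]
  rwa [this]

/-- Such a `q` stays inside every term of the derived series of `I`. -/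
theorem eq_bot_of_le_lieSpanSubmodule (I : LieIdeal K L) [IsSolvable I] {q : Submodule K L}
    (hI : q ≤ I.toSubmodule) (hq : q ≤ lieSpanSubmodule q q) : q = ⊥ := by
  have h : ∀ k, q ≤ (derivedSeriesOfIdeal K L k I).toSubmodule := by
    intro k
    induction k with
    | zero => exact hI
    | succ k ih =>
      refine hq.trans (lieSpanSubmodule_le fun a ha b hb => ?_)
      rw [derivedSeriesOfIdeal_succ]
      exact LieSubmodule.lie_mem_lie (ih ha) (ih hb)
  obtain ⟨k, hk⟩ := IsSolvable.solvable K I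
  rw [LieIdeal.derivedSeries_eq_bot_iff] at hk
  have := h k
  rw [hk] at this
  simpa using this

variable [CharZero K] [Module.Finite K L]

/-- The key linearisation step for Levi's theorem: a subalgebra `s` complementing the radical up
to `q = s ⊓ radical` admits a linear map `s → q`, the identity on `q` modulo `⁅q, q⁆`, which commutes
with `s` up to inner derivations and is invariant under commuting semisimple elements
normalizing `s`. -/
theorem exists_equivariant_projection (T : Set L) (hT : ∀ x ∈ T, ∀ y ∈ T, ⁅x, y⁆ = 0)
    (hss : ∀ x ∈ T, (ad K L x).IsSemisimple) (s : LieSubalgebra K L)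
    (hs : s.toSubmodule ⊔ (radical K L).toSubmodule = ⊤)
    (hTs : ∀ x ∈ T, ∀ y ∈ s, ⁅x, y⁆ ∈ s) {q q' : Submodule K L}
    (hq : q = s.toSubmodule ⊓ (radical K L).toSubmodule) (hq' : q' = lieSpanSubmodule q q) :
    ∃ φ : L →ₗ[K] L, (∀ v ∈ s, φ v ∈ q) ∧ (∀ v ∈ q, φ v - v ∈ q') ∧
      (∀ x ∈ s, ∃ y ∈ q, ⁅x + y, φ⁆ ∈ mapsToSubmodule s.toSubmodule q') ∧
      (∀ y ∈ q, ⁅y, φ⁆ + ad K L y ∈ mapsToSubmodule s.toSubmodule q') ∧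
      ∀ x ∈ T, ⁅x, φ⁆ = 0 := by
  have hqs : q ≤ s.toSubmodule := hq ▸ inf_le_left
  have nq : ∀ {x : L}, (∀ y ∈ s, ⁅x, y⁆ ∈ s) → ∀ v ∈ q, ⁅x, v⁆ ∈ q := fun {x} hx v hv => by
    rw [hq] at hv ⊢
    exact ⟨hx v hv.1, (radical K L).lie_mem hv.2⟩
  have nq' : ∀ {x : L}, (∀ y ∈ s, ⁅x, y⁆ ∈ s) → ∀ v ∈ q', ⁅x, v⁆ ∈ q' := fun {x} hx v hv => by
    rw [hq'] at hv ⊢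
    exact lie_lieSpanSubmodule_mem (nq hx) (nq hx) hv
  have ns : ∀ {x : L}, x ∈ s → ∀ y ∈ s, ⁅x, y⁆ ∈ s := fun hx y hy => s.lie_mem hx hy
  have hq'q : q' ≤ q := by
    rw [hq']
    exact lieSpanSubmodule_le fun a ha b hb => nq (ns (hqs ha)) b hb
  have hqq : ∀ a ∈ q, ∀ b ∈ q, ⁅a, b⁆ ∈ q' := fun a ha b hb =>
    hq' ▸ lie_mem_lieSpanSubmodule ha hb
  have hsq : ∀ y ∈ q, ∀ v ∈ s, ⁅y, v⁆ ∈ q := fun y hy v hv => by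
    rw [← lie_skew]
    exact neg_mem (nq (ns hv) y hy)
  obtain ⟨g, hg⟩ := q.subtype.exists_leftInverse_of_injective (by simp)
  let π : L →ₗ[K] L := q.subtype ∘ₗ g
  have hπq : ∀ v, π v ∈ q := fun v => (g v).2
  have hπ : ∀ v ∈ q, π v = v := fun v hv =>
    congrArg Subtype.val (LinearMap.congr_fun hg ⟨v, hv⟩)
  -- Weyl's theorem will be applied to the image of `C` modulo `A`. The algebra `s` sends `C` into
  -- `B`, since `π` is the identity on `q`. Including `ad q` in `A` makes `q` act trivially there,
  -- because `⁅y, π⁆` equals `-ad y` modulo `Z`; the action then factors through `s / q`, the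
  -- semisimple quotient of `L`.
  let Z := mapsToSubmodule s.toSubmodule q'
  let B := mapsToSubmodule s.toSubmodule q ⊓ mapsToSubmodule q q'
  let C := B ⊔ Submodule.span K {π}
  let A := Z ⊔ q.map (ad K L : L →ₗ[K] L →ₗ[K] L)
  have hZ : ∀ {x : L}, (∀ y ∈ s, ⁅x, y⁆ ∈ s) → ∀ φ ∈ Z, ⁅x, φ⁆ ∈ Z := fun hx φ hφ =>
    lie_mem_mapsToSubmodule hx (nq' hx) hφ
  have hB : ∀ {x : L}, (∀ y ∈ s, ⁅x, y⁆ ∈ s) → ∀ φ ∈ B, ⁅x, φ⁆ ∈ B := fun hx φ hφ =>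
    ⟨lie_mem_mapsToSubmodule hx (nq hx) hφ.1, lie_mem_mapsToSubmodule (nq hx) (nq' hx) hφ.2⟩
  have hC : ∀ {x : L}, (∀ y ∈ s, ⁅x, y⁆ ∈ s) → ∀ φ ∈ C, ⁅x, φ⁆ ∈ B := by
    intro x hx φ hφ
    obtain ⟨b, hb, p, hp, rfl⟩ := Submodule.mem_sup.mp hφ
    obtain ⟨c, rfl⟩ := Submodule.mem_span_singleton.mp hp
    rw [lie_add, lie_smul]
    refine add_mem (hB hx b hb) (B.smul_mem c ⟨fun v hv => ?_, fun v hv => ?_⟩)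
    · rw [LieHom.lie_apply]
      exact sub_mem (nq hx _ (hπq v)) (hπq _)
    · rw [LieHom.lie_apply, hπ v hv, hπ _ (nq hx v hv), sub_self]
      exact zero_mem _
  have hA : ∀ {x : L}, (∀ y ∈ s, ⁅x, y⁆ ∈ s) → ∀ φ ∈ A, ⁅x, φ⁆ ∈ A := by
    intro x hx φ hφ
    obtain ⟨z, hz, _, ⟨y, hy, rfl⟩, rfl⟩ := Submodule.mem_sup.mp hφ
    have : ⁅x, (ad K L y : L →ₗ[K] L)⁆ = ad K L ⁅x, y⁆ := by
      ext v
      simp [LieHom.lie_apply]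
    rw [lie_add]
    refine add_mem (Submodule.mem_sup_left (hZ hx z hz)) (Submodule.mem_sup_right ?_)
    exact ⟨⁅x, y⁆, nq hx y hy, this.symm⟩
  have hqB : ∀ y ∈ q, ∀ φ ∈ B, ⁅y, φ⁆ ∈ Z := fun y hy φ hφ v hv => by
    rw [LieHom.lie_apply]
    exact sub_mem (hqq y hy _ (hφ.1 v hv)) (hφ.2 _ (hsq y hy v hv))
  have hqπ : ∀ y ∈ q, ⁅y, π⁆ + ad K L y ∈ Z := fun y hy v hv => by
    rw [LinearMap.add_apply, LieHom.lie_apply, ad_apply, hπ _ (hsq y hy v hv), sub_add_cancel]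
    exact hqq y hy _ (hπq v)
  have hqC : ∀ y ∈ q, ∀ φ ∈ C, ⁅y, φ⁆ ∈ A := by
    intro y hy φ hφ
    obtain ⟨b, hb, p, hp, rfl⟩ := Submodule.mem_sup.mp hφ
    obtain ⟨c, rfl⟩ := Submodule.mem_span_singleton.mp hp
    rw [lie_add, lie_smul]
    refine add_mem (Submodule.mem_sup_left (hqB y hy b hb)) (A.smul_mem c ?_)
    rw [show ⁅y, π⁆ = (⁅y, π⁆ + ad K L y) + ad K L (-y) by rw [map_neg]; abel]
    exact add_mem (Submodule.mem_sup_left (hqπ y hy))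
      (Submodule.mem_sup_right ⟨-y, neg_mem hy, rfl⟩)
  have hact : ∀ (x : s) (φ : L →ₗ[K] L), ⁅x, φ⁆ = ⁅(x : L), φ⁆ := fun x φ => rfl
  have hπC : π ∈ C := Submodule.mem_sup_right (Submodule.mem_span_singleton_self π)
  have hBC : B ≤ C := le_sup_left
  obtain ⟨b, hb, hbA⟩ := exists_sub_invariant_of_surjective_of_le
    ((radicalQuotientHom K L).comp s.incl)
    (fun z => by
      obtain ⟨x, rfl⟩ := radicalQuotientHom_surjective z
      obtain ⟨a, ha, r, hr, rfl⟩ := Submodule.mem_sup.mp (hs.ge (Submodule.mem_top (x := x)))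
      refine ⟨⟨a, ha⟩, ?_⟩
      rw [map_add, radicalQuotientHom_eq_zero.mpr hr, add_zero]
      rfl)
    ({ A with lie_mem := fun {x m} hm => hA (ns x.2) m hm } : LieSubmodule K s (L →ₗ[K] L))
    ({ B with lie_mem := fun {x m} hm => hB (ns x.2) m hm } : LieSubmodule K s (L →ₗ[K] L))
    ({ C with lie_mem := fun {x m} hm => hBC (hC (ns x.2) m hm) } :
      LieSubmodule K s (L →ₗ[K] L))
    (fun x hx m hm => hqC x (hq ▸ ⟨x.2, radicalQuotientHom_eq_zero.mp hx⟩) m hm)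
    (fun x m hm => hC (ns x.2) m hm) (m := π) hπC
  -- Elements of `C` that are `s`-invariant modulo `A`. As `T` normalizes `s`, it preserves `D`, and
  -- it maps `D` into `B`; the projection can be moved within its class modulo `B` to be fixed by
  -- `T`.
  let D : Submodule K (L →ₗ[K] L) :=
    { carrier := {φ | φ ∈ C ∧ ∀ x ∈ s, ⁅x, φ⁆ ∈ A}
      zero_mem' := ⟨C.zero_mem, fun x _ => by rw [lie_zero]; exact A.zero_mem⟩
      add_mem' := fun h₁ h₂ => ⟨add_mem h₁.1 h₂.1, fun x hx => by
        rw [lie_add]; exact add_mem (h₁.2 x hx) (h₂.2 x hx)⟩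
      smul_mem' := fun c _ h => ⟨C.smul_mem c h.1, fun x hx => by
        rw [lie_smul]; exact A.smul_mem c (h.2 x hx)⟩ }
  obtain ⟨φ, hφD, hφB, hφT⟩ := Module.End.exists_sub_forall_apply_eq_zero
    (toEnd K L (L →ₗ[K] L) '' T)
    (by rintro _ ⟨x, hx, rfl⟩; exact isSemisimple_toEnd_linearMap (hss x hx))
    (by
      rintro _ ⟨x, hx, rfl⟩ _ ⟨y, hy, rfl⟩
      rw [commute_iff_lie_eq, ← LieHom.map_lie, hT x hx y hy, map_zero])
    D B
    (by
      rintro _ ⟨x, hx, rfl⟩ φ hφ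
      refine ⟨hBC (hC (hTs x hx) φ hφ.1), fun y hy => ?_⟩
      rw [toEnd_apply_apply, leibniz_lie y x φ]
      refine add_mem (hφ.2 _ ?_) (hA (hTs x hx) _ (hφ.2 y hy))
      rw [← lie_skew]
      exact neg_mem (hTs x hx y hy))
    (by rintro _ ⟨x, hx, rfl⟩ φ hφ; exact hC (hTs x hx) φ hφ.1)
    (d := π - b) ⟨sub_mem hπC (hBC hb), fun x hx => hbA ⟨x, hx⟩⟩
  obtain ⟨β, hβ, rfl⟩ : ∃ β ∈ B, φ = π - β :=
    ⟨b + (π - b - φ), add_mem hb hφB, by abel⟩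
  have hqφ : ∀ y ∈ q, ⁅y, π - β⁆ + ad K L y ∈ Z := fun y hy => by
    rw [lie_sub, show ⁅y, π⁆ - ⁅y, β⁆ + ad K L y = (⁅y, π⁆ + ad K L y) - ⁅y, β⁆ by abel]
    exact sub_mem (hqπ y hy) (hqB y hy β hβ)
  refine ⟨π - β, fun v hv => sub_mem (hπq v) (hβ.1 v hv), fun v hv => ?_, fun x hx => ?_, hqφ,
    fun x hx => hφT _ ⟨x, hx, rfl⟩⟩
  · rw [LinearMap.sub_apply, hπ v hv, sub_sub_cancel_left]
    exact neg_mem (hβ.2 v hv)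
  -- The term `ad y` left over in `⁅x, π - β⁆` is cancelled, modulo `Z`, by adding `⁅y, π - β⁆`.
  · obtain ⟨z, hz, _, ⟨y, hy, rfl⟩, hzy⟩ := Submodule.mem_sup.mp (hφD.2 x hx)
    refine ⟨y, hy, ?_⟩
    rw [add_lie, ← hzy, show ∀ a b c : L →ₗ[K] L, a + b + c = a + (c + b) by intros; abel]
    exact add_mem hz (hqφ y hy)

/-- **Levi's theorem**, equivariant version: the radical has a complementary subalgebra normalized
by a given commuting set of ad-semisimple elements. -/
theorem exists_isCompl_radical_of_isSemisimple (T : Set L) (hT : ∀ x ∈ T, ∀ y ∈ T, ⁅x, y⁆ = 0)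
    (hss : ∀ x ∈ T, (ad K L x).IsSemisimple) :
    ∃ s : LieSubalgebra K L, IsCompl s.toSubmodule (radical K L).toSubmodule ∧
      ∀ x ∈ T, ∀ y ∈ s, ⁅x, y⁆ ∈ s := by
  let P : Set (LieSubalgebra K L) :=
    {s | s.toSubmodule ⊔ (radical K L).toSubmodule = ⊤ ∧ ∀ x ∈ T, ∀ y ∈ s, ⁅x, y⁆ ∈ s}
  obtain ⟨s, ⟨hs, hTs⟩, hmin⟩ := (InvImage.wf (LieSubalgebra.toSubmodule (R := K) (L := L))
    wellFounded_lt).has_min P ⟨⊤, by simp, by simp⟩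
  replace hmin : ∀ l ∈ P, l ≤ s → s ≤ l := fun l hl hle => by
    by_contra h
    exact hmin l hl (lt_of_le_not_ge (α := Submodule K L) hle h)
  refine ⟨s, ⟨disjoint_iff.mpr ?_, codisjoint_iff.mpr hs⟩, hTs⟩
  obtain ⟨q, hq⟩ : ∃ q, q = s.toSubmodule ⊓ (radical K L).toSubmodule := ⟨_, rfl⟩
  obtain ⟨q', hq'⟩ : ∃ q', q' = lieSpanSubmodule q q := ⟨_, rfl⟩
  obtain ⟨φ, hφs, hφq, hφx, hφy, hφT⟩ := exists_equivariant_projection T hT hss s hs hTs hq hq'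
  have hqs : q ≤ s.toSubmodule := hq ▸ inf_le_left
  have hqr : q ≤ (radical K L).toSubmodule := hq ▸ inf_le_right
  have nq : ∀ {x : L}, (∀ y ∈ s, ⁅x, y⁆ ∈ s) → ∀ v ∈ q, ⁅x, v⁆ ∈ q := fun {x} hx v hv => by
    rw [hq] at hv ⊢
    exact ⟨hx v hv.1, (radical K L).lie_mem hv.2⟩
  have nq' : ∀ {x : L}, (∀ y ∈ s, ⁅x, y⁆ ∈ s) → ∀ v ∈ q', ⁅x, v⁆ ∈ q' := fun {x} hx v hv => by
    rw [hq'] at hv ⊢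
    exact lie_lieSpanSubmodule_mem (nq hx) (nq hx) hv
  have ns : ∀ {x : L}, x ∈ s → ∀ y ∈ s, ⁅x, y⁆ ∈ s := fun hx y hy => s.lie_mem hx hy
  have hZ : ∀ {x : L}, (∀ y ∈ s, ⁅x, y⁆ ∈ s) → ∀ ψ ∈ mapsToSubmodule s.toSubmodule q',
      ⁅x, ψ⁆ ∈ mapsToSubmodule s.toSubmodule q' := fun hx ψ hψ =>
    lie_mem_mapsToSubmodule hx (nq' hx) hψ
  -- Since `L = [L, L] + rad L`, the derived algebra of `s` also covers `L` modulo the radical;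
  -- minimality makes `s` perfect.
  have hperf : s.toSubmodule ≤ lieSpanSubmodule s.toSubmodule s.toSubmodule := by
    let d : LieSubalgebra K L :=
      { lieSpanSubmodule s.toSubmodule s.toSubmodule with
        lie_mem' := fun {x y} hx hy => by
          have hle : lieSpanSubmodule s.toSubmodule s.toSubmodule ≤ s.toSubmodule :=
            lieSpanSubmodule_le fun a ha b hb => s.lie_mem ha hb
          exact lie_mem_lieSpanSubmodule (hle hx) (hle hy) }
    refine hmin d ⟨?_, fun x hx y hy => lie_lieSpanSubmodule_mem (hTs x hx) (hTs x hx) hy⟩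
      (lieSpanSubmodule_le fun a ha b hb => s.lie_mem ha hb)
    have h := congrArg LieSubmodule.toSubmodule (lie_top_sup_radical (K := K) (L := L))
    rw [LieSubmodule.sup_toSubmodule, LieSubmodule.lieIdeal_oper_eq_linear_span',
      LieSubmodule.top_toSubmodule] at h
    rw [eq_top_iff, ← h]
    refine sup_le (Submodule.span_le.mpr ?_) le_sup_right
    rintro _ ⟨a, -, b, -, rfl⟩
    obtain ⟨a, ha, r, hr, rfl⟩ := Submodule.mem_sup.mp (hs.ge (Submodule.mem_top (x := a)))
    obtain ⟨b, hb, t, ht, rfl⟩ := Submodule.mem_sup.mp (hs.ge (Submodule.mem_top (x := b)))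
    rw [lie_add, add_lie, add_assoc]
    refine Submodule.add_mem_sup (lie_mem_lieSpanSubmodule ha hb)
      (add_mem (lie_mem_left _ _ _ _ _ hr) ((radical K L).lie_mem ht))
  -- The stabilizer of `φ` modulo maps into `q'`. It still covers `L` modulo the radical and is
  -- normalized by `T`, so minimality gives `s = l`.
  let l : LieSubalgebra K L :=
    { carrier := {x | x ∈ s ∧ ⁅x, φ⁆ ∈ mapsToSubmodule s.toSubmodule q'}
      zero_mem' := ⟨s.zero_mem, by rw [zero_lie]; exact zero_mem _⟩
      add_mem' := fun h₁ h₂ => ⟨s.add_mem h₁.1 h₂.1, by rw [add_lie]; exact add_mem h₁.2 h₂.2⟩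
      smul_mem' := fun c _ h => ⟨s.smul_mem c h.1, by
        rw [smul_lie]; exact Submodule.smul_mem _ c h.2⟩
      lie_mem' := fun h₁ h₂ => ⟨s.lie_mem h₁.1 h₂.1, by
        rw [lie_lie]
        exact sub_mem (hZ (ns h₁.1) _ h₂.2) (hZ (ns h₂.1) _ h₁.2)⟩ }
  have hsl : s ≤ l := by
    refine hmin l ⟨?_, fun x hx y hy => ⟨hTs x hx y hy.1, ?_⟩⟩ fun x hx => hx.1
    · rw [eq_top_iff, ← hs]
      refine sup_le (fun x hx => ?_) le_sup_right
      obtain ⟨y, hy, hxy⟩ := hφx x hx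
      rw [show x = (x + y) + (-y) by abel]
      exact Submodule.add_mem_sup (⟨s.add_mem hx (hqs hy), hxy⟩ : x + y ∈ l) (hqr (neg_mem hy))
    · rw [lie_lie, hφT x hx, lie_zero, sub_zero]
      exact hZ (hTs x hx) _ hy.2
  -- For `y` in `q`, both `⁅y, φ⁆` and `⁅y, φ⁆ + ad y` now send `s` into `q'`.
  have hsq : ∀ x ∈ s, ∀ y ∈ q, ⁅x, y⁆ ∈ q' := fun x hx y hy => by
    have h := sub_mem (hφy y hy x hx) ((hsl (hqs hy)).2 x hx)
    rw [LinearMap.add_apply, add_sub_cancel_left, ad_apply] at h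
    rw [← lie_skew]
    exact neg_mem h
  -- On brackets, `φ ⁅a, b⁆` agrees with `⁅a, φ b⁆` modulo `q'`, and the latter is in `q'`. So `φ`
  -- maps the perfect `s` into `q'`; being the identity on `q` modulo `q'`, it forces `q ≤ [q, q]`.
  have hφ : s.toSubmodule ≤ q'.comap φ := hperf.trans <| lieSpanSubmodule_le fun a ha b hb => by
    have h := (hsl ha).2 b hb
    rw [LieHom.lie_apply] at h
    have h' := sub_mem (hsq a ha _ (hφs b hb)) h
    rwa [sub_sub_cancel] at h'
  rw [← hq]
  refine eq_bot_of_le_lieSpanSubmodule (radical K L) hqr fun v hv => ?_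
  rw [← hq']
  have hφv : φ v ∈ q' := hφ (hqs hv)
  have := sub_mem hφv (hφq v hv)
  rwa [sub_sub_cancel] at this

end LieAlgebra

/-! ### Equivariant complete reducibility -/

namespace LieModule

open Module LieAlgebra

variable {K L V : Type*} [Field K] [CharZero K] [LieRing L] [LieAlgebra K L] [Module.Finite K L]
  [HasTrivialRadical K L] [AddCommGroup V] [Module K V] [LieRingModule L V] [LieModule K L V]
  [Module.Finite K V]

/-- Complete reducibility for the action of a semisimple Lie algebra together with commuting
semisimple endomorphisms commuting with this action. -/
theorem exists_equivariant_projection_of_hasTrivialRadical (U : Set (End K V))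
    (hU : ∀ u ∈ U, u.IsSemisimple) (hUU : ∀ u ∈ U, ∀ v ∈ U, Commute u v)
    (hUL : ∀ u ∈ U, ∀ (x : L) (v : V), u ⁅x, v⁆ = ⁅x, u v⁆) (W : Submodule K V)
    (hWL : ∀ (x : L), ∀ v ∈ W, ⁅x, v⁆ ∈ W) (hWU : ∀ u ∈ U, ∀ v ∈ W, u v ∈ W) :
    ∃ φ : End K V, (∀ v, φ v ∈ W) ∧ (∀ v ∈ W, φ v = v) ∧
      (∀ (x : L) (v : V), φ ⁅x, v⁆ = ⁅x, φ v⁆) ∧ ∀ u ∈ U, Commute u φ := by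
  obtain ⟨g, hg⟩ := W.subtype.exists_leftInverse_of_injective (by simp)
  let π : V →ₗ[K] V := W.subtype ∘ₗ g
  have hπW : ∀ v, π v ∈ W := fun v => (g v).2
  have hπ : ∀ v ∈ W, π v = v := fun v hv =>
    congrArg Subtype.val (LinearMap.congr_fun hg ⟨v, hv⟩)
  -- Differences of projections onto `W` lie in `B`, so changing `π` by an element of `B` gives
  -- another projection.
  let B : Submodule K (V →ₗ[K] V) :=
    { carrier := {φ | (∀ v, φ v ∈ W) ∧ ∀ v ∈ W, φ v = 0}
      zero_mem' := ⟨fun _ => W.zero_mem, fun _ _ => rfl⟩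
      add_mem' := fun h₁ h₂ => ⟨fun v => W.add_mem (h₁.1 v) (h₂.1 v), fun v hv => by
        rw [LinearMap.add_apply, h₁.2 v hv, h₂.2 v hv, add_zero]⟩
      smul_mem' := fun c _ h => ⟨fun v => W.smul_mem c (h.1 v), fun v hv => by
        rw [LinearMap.smul_apply, h.2 v hv, smul_zero]⟩ }
  let C := B ⊔ Submodule.span K {π}
  have hBC : B ≤ C := le_sup_left
  have hπC : π ∈ C := Submodule.mem_sup_right (Submodule.mem_span_singleton_self π)
  have hC : ∀ f : End K V, (∀ v ∈ W, f v ∈ W) → ∀ φ ∈ C, f * φ - φ * f ∈ B := by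
    intro f hf φ hφ
    obtain ⟨b, hb, p, hp, rfl⟩ := Submodule.mem_sup.mp hφ
    obtain ⟨c, rfl⟩ := Submodule.mem_span_singleton.mp hp
    refine ⟨fun v => ?_, fun v hv => ?_⟩
    · simp only [LinearMap.sub_apply, End.mul_apply, LinearMap.add_apply, LinearMap.smul_apply]
      exact sub_mem (hf _ (add_mem (hb.1 v) (W.smul_mem c (hπW v))))
        (add_mem (hb.1 _) (W.smul_mem c (hπW _)))
    · simp [hb.2 v hv, hb.2 _ (hf v hv), hπ v hv, hπ _ (hf v hv)]
  have hlie : ∀ (x : L) (φ : V →ₗ[K] V),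
      ⁅x, φ⁆ = toEnd K L V x * φ - φ * toEnd K L V x := fun x φ => by
    ext v
    simp [LieHom.lie_apply]
  have hCL : ∀ (x : L), ∀ φ ∈ C, ⁅x, φ⁆ ∈ B := fun x φ hφ => by
    rw [hlie]
    exact hC _ (hWL x) φ hφ
  obtain ⟨b, hb, hbL⟩ := exists_sub_invariant_of_surjective_of_le (LieHom.id : L →ₗ⁅K⁆ L)
    Function.surjective_id (⊥ : LieSubmodule K L (V →ₗ[K] V))
    ({ B with lie_mem := fun {x m} hm => hCL x m (hBC hm) } : LieSubmodule K L (V →ₗ[K] V))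
    ({ C with lie_mem := fun {x m} hm => hBC (hCL x m hm) } : LieSubmodule K L (V →ₗ[K] V))
    (fun x hx m _ => by rw [show x = 0 from hx, zero_lie]; exact zero_mem _)
    (fun x m hm => hCL x m hm) (m := π) hπC
  let D : Submodule K (End K V) :=
    { carrier := {φ | φ ∈ C ∧ ∀ x : L, Commute (toEnd K L V x) φ}
      zero_mem' := ⟨C.zero_mem, fun _ => Commute.zero_right _⟩
      add_mem' := fun h₁ h₂ => ⟨add_mem h₁.1 h₂.1, fun x => (h₁.2 x).add_right (h₂.2 x)⟩
      smul_mem' := fun c _ h => ⟨C.smul_mem c h.1, fun x => (h.2 x).smul_right c⟩ }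
  have hUL' : ∀ u ∈ U, ∀ x : L, Commute (toEnd K L V x) u := fun u hu x =>
    LinearMap.ext fun v => (hUL u hu x v).symm
  obtain ⟨φ, hφD, hφB, hφU⟩ := Module.End.exists_sub_forall_apply_eq_zero
    (ad K (End K V) '' U)
    (by rintro _ ⟨u, hu, rfl⟩; exact ad_isSemisimple_of_isSemisimple (hU u hu))
    (by rintro _ ⟨u, hu, rfl⟩ _ ⟨v, hv, rfl⟩; exact commute_ad_of_commute (hUU u hu v hv))
    D B
    (by
      rintro _ ⟨u, hu, rfl⟩ φ hφ
      rw [ad_apply, Ring.lie_def]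
      exact ⟨hBC (hC u (hWU u hu) φ hφ.1), fun x =>
        ((hUL' u hu x).mul_right (hφ.2 x)).sub_right ((hφ.2 x).mul_right (hUL' u hu x))⟩)
    (by
      rintro _ ⟨u, hu, rfl⟩ φ hφ
      rw [ad_apply, Ring.lie_def]
      exact hC u (hWU u hu) φ hφ.1)
    (d := π - b) ⟨sub_mem hπC (hBC hb), fun x => by
      have := (LieSubmodule.mem_bot _).mp (hbL x)
      rw [hlie, sub_eq_zero] at this
      exact this⟩
  obtain ⟨β, hβ, rfl⟩ : ∃ β ∈ B, φ = π - β :=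
    ⟨b + (π - b - φ), add_mem hb hφB, by abel⟩
  refine ⟨π - β, fun v => sub_mem (hπW v) (hβ.1 v), fun v hv => ?_, fun x v => ?_, fun u hu => ?_⟩
  · rw [LinearMap.sub_apply, hπ v hv, hβ.2 v hv, sub_zero]
  · exact (LinearMap.congr_fun (hφD.2 x).eq v).symm
  · have := hφU _ ⟨u, hu, rfl⟩
    rw [ad_apply] at this
    exact commute_iff_lie_eq.mpr this

/-- A nilpotent endomorphism commuting with the action of a semisimple Lie algebra and preserving
all submodules vanishes. -/
theorem eq_zero_of_isNilpotent_of_forall_submodule {f : End K V} (hf : _root_.IsNilpotent f)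
    (hfL : ∀ (x : L) (v : V), f ⁅x, v⁆ = ⁅x, f v⁆)
    (hfW : ∀ W : LieSubmodule K L V, ∀ v ∈ W, f v ∈ W) : f = 0 := by
  obtain ⟨φ, hφW, hφ, hφL, -⟩ := exists_equivariant_projection_of_hasTrivialRadical (L := L)
    (∅ : Set (End K V)) (by simp) (by simp) (by simp) (LinearMap.ker f)
    (fun x v hv => by rw [LinearMap.mem_ker] at hv ⊢; rw [hfL, hv, lie_zero]) (by simp)
  let W : LieSubmodule K L V := { LinearMap.ker φ with
    lie_mem := fun {x v} (hv : φ v = 0) => show φ ⁅x, v⁆ = 0 by rw [hφL, hv, lie_zero] }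
  -- On the invariant complement `W` of its kernel, `f` is both injective and nilpotent, so `W`
  -- vanishes.
  have hW : ∀ k, ∀ v ∈ W, (f ^ k) v = 0 → v = 0 := by
    intro k
    induction k with
    | zero => intro v _ hv; simpa using hv
    | succ k ih =>
      intro v hv hk
      rw [pow_succ, End.mul_apply] at hk
      have h0 : f v = 0 := ih _ (hfW W v hv) hk
      rw [← hφ v h0]
      exact hv
  obtain ⟨k, hk⟩ := hf
  ext v
  have h1 : v - φ v ∈ W := show φ (v - φ v) = 0 by rw [map_sub, hφ _ (hφW v), sub_self]
  have h2 := hW k _ h1 (by rw [hk]; rfl)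
  rw [sub_eq_zero.mp h2]
  exact hφW v

end LieModule

/-! ### Jordan–Chevalley components and maximal commuting families -/

namespace Module.End

open LieAlgebra Polynomial

variable {K V : Type*} [Field K] [AddCommGroup V] [Module K V]

theorem apply_mem_of_mem_adjoin {f g : End K V} (hg : g ∈ Algebra.adjoin K {f})
    {p : Submodule K V} (hp : ∀ v ∈ p, f v ∈ p) : ∀ v ∈ p, g v ∈ p := by
  obtain ⟨q, rfl⟩ := Algebra.adjoin_mem_exists_aeval K f hg
  exact fun v hv => q.aeval_apply_smul_mem_of_le_comap hv f hp

/-- If a subspace `p` contains the image of `ad x`, it contains the image of the adjoint actions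
of the Jordan-Chevalley components of `x`. -/
theorem lie_mem_of_ad_mem_adjoin {x s : End K V} (hx : x ≠ 0) (hxs : Commute x s)
    (hs : ad K _ s ∈ Algebra.adjoin K {ad K _ x}) {p : Submodule K (End K V)} {g : Set (End K V)}
    (hp : ∀ y ∈ g, ⁅x, y⁆ ∈ p) (hpg : ∀ y ∈ p, y ∈ g) {y : End K V} (hy : y ∈ g) :
    ⁅s, y⁆ ∈ p := by
  obtain ⟨q, hq⟩ := Algebra.adjoin_mem_exists_aeval K _ hs
  have key : ∀ z, ⁅s, z⁆ = aeval (ad K _ x) q.divX ⁅x, z⁆ + q.coeff 0 • z := fun z => by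
    rw [← ad_apply K, ← hq]
    conv_lhs => rw [← q.divX_mul_X_add]
    simp
  -- Evaluating `ad s = q(ad x)` at `x` itself leaves only the constant term, and `⁅s, x⁆ = 0`.
  have h0 : q.coeff 0 = 0 := by
    have := key x
    rw [lie_self, map_zero, zero_add, commute_iff_lie_eq.mp hxs.symm, eq_comm,
      smul_eq_zero] at this
    exact this.resolve_right hx
  rw [key, h0, zero_smul, add_zero]
  exact q.divX.aeval_apply_smul_mem_of_le_comap (hp y hy) _ fun z hz => hp z (hpg z hz)

/-- If `ad y` restricts to a semisimple endomorphism of a subspace, then the nilpotent part of `y`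
commutes with this subspace. -/
theorem lie_eq_zero_of_semisimple_restrict [PerfectField K] [FiniteDimensional K V]
    {x n s : End K V} (hx : x.IsSemisimple) (hn : IsNilpotent n) (hs : s.IsSemisimple)
    (hns : Commute n s) {p : Submodule K (End K V)} (hp : ∀ w ∈ p, ⁅x, w⁆ ∈ p)
    (h : ∀ w ∈ p, ⁅x, w⁆ = ⁅n + s, w⁆) : ∀ w ∈ p, ⁅n, w⁆ = 0 := by
  have hp' : ∀ w ∈ p, ad K _ (n + s) w ∈ p := fun w hw => by
    rw [ad_apply, ← h w hw]
    exact hp w hw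
  have hpn := apply_mem_of_mem_adjoin (ad_mem_adjoin_of_isNilpotent (K := K) hns hn hs) hp'
  have hps := apply_mem_of_mem_adjoin (ad_mem_adjoin_of_isSemisimple (K := K) hns hn hs) hp'
  have hpx : ∀ w ∈ p, ad K _ x w ∈ p := hp
  -- Two Jordan decompositions of the same operator on `p`; by uniqueness the nilpotent part `ad n`
  -- is zero there.
  have hsum : (ad K _ n).restrict hpn + (ad K _ s).restrict hps = 0 + (ad K _ x).restrict hpx := by
    ext w : 1
    apply Subtype.ext
    have := h w w.2
    rw [add_lie] at this
    simpa using this.symm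
  have := (isNilpotent_isSemisimple_unique
    (isNilpotent.restrict hpn (ad_nilpotent_of_nilpotent (R := K) hn))
    ((ad_isSemisimple_of_isSemisimple hs).restrict (p := p) hps) IsNilpotent.zero
    ((ad_isSemisimple_of_isSemisimple hx).restrict (p := p) hpx)
    (LinearMap.restrict_commute (commute_ad_of_commute hns) hpn hps) (Commute.zero_left _) hsum).1
  intro w hw
  exact congrArg Subtype.val (LinearMap.congr_fun this ⟨w, hw⟩)

/-- A subspace of commuting semisimple endomorphisms inside `g` is contained in a maximal one. -/
theorem exists_maximal_commuting_semisimple [PerfectField K] [FiniteDimensional K V]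
    (t g : Submodule K (End K V)) (htg : t ≤ g) (htc : ∀ x ∈ t, ∀ y ∈ t, Commute x y)
    (hts : ∀ x ∈ t, x.IsSemisimple) :
    ∃ T : Submodule K (End K V), t ≤ T ∧ T ≤ g ∧ (∀ x ∈ T, ∀ y ∈ T, Commute x y) ∧
      (∀ x ∈ T, x.IsSemisimple) ∧
      ∀ z ∈ g, z.IsSemisimple → (∀ x ∈ T, Commute x z) → z ∈ T := by
  obtain ⟨T, ⟨htT, hTg, hTc, hTs⟩, hmax⟩ := wellFounded_gt.has_min
    {T : Submodule K (End K V) | t ≤ T ∧ T ≤ g ∧ (∀ x ∈ T, ∀ y ∈ T, Commute x y) ∧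
      ∀ x ∈ T, x.IsSemisimple} ⟨t, le_rfl, htg, htc, hts⟩
  refine ⟨T, htT, hTg, hTc, hTs, fun z hzg hzs hz => ?_⟩
  by_contra hzT
  refine hmax (T ⊔ Submodule.span K {z}) ⟨htT.trans le_sup_left, sup_le hTg ?_, ?_, ?_⟩
    (left_lt_sup.mpr fun h => hzT (h (Submodule.mem_span_singleton_self z)))
  · rwa [Submodule.span_singleton_le_iff_mem]
  · intro x hx y hy
    obtain ⟨a, ha, _, hb, rfl⟩ := Submodule.mem_sup.mp hx
    obtain ⟨c, rfl⟩ := Submodule.mem_span_singleton.mp hb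
    obtain ⟨a', ha', _, hb', rfl⟩ := Submodule.mem_sup.mp hy
    obtain ⟨c', rfl⟩ := Submodule.mem_span_singleton.mp hb'
    exact ((hTc a ha a' ha').add_right ((hz a ha).smul_right c')).add_left
      (((hz a' ha').symm.smul_left c).add_right
        (((Commute.refl z).smul_left c).smul_right c'))
  · intro x hx
    obtain ⟨a, ha, _, hb, rfl⟩ := Submodule.mem_sup.mp hx
    obtain ⟨c, rfl⟩ := Submodule.mem_span_singleton.mp hb
    exact (hTs a ha).add_of_commute ((hz a ha).smul_right c) (IsSemisimple_smul c hzs)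

end Module.End

/-! ### Decomposable algebras and the Levi factor -/

open LieAlgebra Module

/-- A subalgebra complementary to the radical is semisimple. -/
theorem LieAlgebra.hasTrivialRadical_of_isCompl_radical {K L : Type*} [Field K] [CharZero K]
    [LieRing L] [LieAlgebra K L] [Module.Finite K L] (s : LieSubalgebra K L)
    (hs : IsCompl s.toSubmodule (radical K L).toSubmodule) : HasTrivialRadical K s := by
  let f : s →ₗ⁅K⁆ L ⧸ radical K L := (radicalQuotientHom K L).comp s.incl
  have hf : Function.Bijective f := by
    refine ⟨(injective_iff_map_eq_zero f).mpr fun x hx => ?_, fun z => ?_⟩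
    · have h : (x : L) ∈ s.toSubmodule ⊓ (radical K L).toSubmodule :=
        ⟨x.2, radicalQuotientHom_eq_zero.mp hx⟩
      rw [hs.inf_eq_bot] at h
      exact Subtype.ext h
    · obtain ⟨x, rfl⟩ := radicalQuotientHom_surjective z
      obtain ⟨a, ha, r, hr, rfl⟩ :=
        Submodule.mem_sup.mp (hs.sup_eq_top.ge (Submodule.mem_top (x := x)))
      refine ⟨⟨a, ha⟩, ?_⟩
      rw [map_add, radicalQuotientHom_eq_zero.mpr hr, add_zero]
      rfl
  have := isKilling_of_equiv (LieEquiv.ofBijective f hf).symm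
  infer_instance

section

variable {K V : Type*} [Field K] [CharZero K] [AddCommGroup V] [Module K V] [FiniteDimensional K V]

/-- A decomposable Lie algebra contains the Jordan-Chevalley components of its elements. -/
theorem IsDecomposable.exists_components {g : LieSubalgebra K (End K V)} (hg : IsDecomposable g)
    {x : End K V} (hx : x ∈ g) :
    ∃ n ∈ Algebra.adjoin K {x}, ∃ s ∈ Algebra.adjoin K {x}, n ∈ g ∧ s ∈ g ∧ IsNilpotent n ∧
      s.IsSemisimple ∧ Commute n s ∧ x = n + s := by
  obtain ⟨n, hn, s, hs, hnn, hss, rfl⟩ := x.exists_isNilpotent_isSemisimple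
  have hc : Commute n s := Algebra.commute_of_mem_adjoin_singleton_of_commute hs
    (Algebra.commute_of_mem_adjoin_self hn).symm
  have hmem : ∀ b, b = s ∨ b = n → b ∈ g := fun b hb => by
    rw [← show decomposableEnvelope g = g from hg]
    exact LieSubalgebra.subset_lieSpan ⟨_, hx, s, n, hss, hnn, commute_iff_lie_eq.mp hc.symm,
      add_comm n s, hb⟩
  exact ⟨n, hn, s, hs, hmem n (Or.inr rfl), hmem s (Or.inl rfl), hnn, hss, hc, rfl⟩

/-- The radical of a decomposable Lie algebra contains the Jordan-Chevalley components of its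
elements. -/
theorem mem_radical_of_components {g : LieSubalgebra K (End K V)} {x n s : g}
    (hx : x ∈ radical K g) (hn : IsNilpotent (n : End K V)) (hs : (s : End K V).IsSemisimple)
    (hc : Commute (n : End K V) s) (hxns : (x : End K V) = n + s) : s ∈ radical K g := by
  by_cases hx0 : (x : End K V) = 0
  · have hs' : (s : End K V) = 0 := by
      refine End.eq_zero_of_isNilpotent_isSemisimple ?_ hs
      rw [hx0] at hxns
      rw [eq_neg_of_add_eq_zero_right hxns.symm]
      exact hn.neg
    rw [show s = 0 from Subtype.ext hs']
    exact zero_mem _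
  -- For `x ≠ 0`, `ad s` is a polynomial without constant term in `ad x`, so `s` is central modulo
  -- the radical.
  refine mem_radical_of_forall_lie_mem fun y => ?_
  have hlie : ∀ y : g, ⁅x, y⁆ ∈ radical K g := fun y => lie_mem_left _ _ _ _ _ hx
  have h := Module.End.lie_mem_of_ad_mem_adjoin (x := (x : End K V)) (s := s)
    (p := (radical K g).toSubmodule.map g.toSubmodule.subtype) (g := g) hx0
    (by rw [hxns]; exact hc.add_left (Commute.refl _))
    (by rw [hxns]; exact ad_mem_adjoin_of_isSemisimple hc hn hs)
    (fun y hy => ⟨_, hlie ⟨y, hy⟩, rfl⟩)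
    (by rintro _ ⟨y, -, rfl⟩; exact y.2) y.2
  obtain ⟨z, hz, hzs⟩ := h
  rw [← lie_skew, ← show z = ⁅s, y⁆ from Subtype.ext hzs]
  exact neg_mem hz

end

theorem mainTheorem9 {K V : Type*} [Field K] [CharZero K] [AddCommGroup V] [Module K V]
    [FiniteDimensional K V] (g t : LieSubalgebra K (Module.End K V))
    (hg : IsDecomposable g) (htg : t ≤ g) (htc : IsLieAbelian t)
    (hts : ∀ A ∈ t, Module.End.IsSemisimple A) :
    ∃ l : LieSubalgebra K (Module.End K V), IsVReductiveLeviFactor g l ∧ t ≤ l := by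
  have htc' : ∀ x ∈ t.toSubmodule, ∀ y ∈ t.toSubmodule, Commute x y := fun x hx y hy =>
    commute_iff_lie_eq.mpr
      (congrArg Subtype.val (LieModule.IsTrivial.trivial (⟨x, hx⟩ : t) (⟨y, hy⟩ : t)))
  obtain ⟨T, htT, hTg, hTc, hTs, hTmax⟩ := End.exists_maximal_commuting_semisimple t.toSubmodule
    g.toSubmodule htg htc' hts
  obtain ⟨n, hn, hgn⟩ := LieModule.exists_nilpotency_ideal (radical K g) V
  have hn' : ∀ x : g, x ∈ n ↔ x ∈ radical K g ∧ IsNilpotent (x : End K V) := hn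
  let T' : Set g := {x | (x : End K V) ∈ T}
  have hTT' : ∀ x ∈ T', ∀ y ∈ T', ⁅x, y⁆ = 0 := fun x hx y hy =>
    Subtype.ext (commute_iff_lie_eq.mp (hTc x hx y hy))
  -- the radical is the sum of its nilpotent elements and of a subspace of `T`
  have hrad : ∀ x ∈ radical K g, ∃ u ∈ radical K g, u ∈ T' ∧ x - u ∈ n := by
    intro x hx
    -- Replaces `x`, modulo `n`, by an element `e` of the radical commuting with `T`; the semisimple
    -- part of `e` is the required `u`.
    obtain ⟨_, ⟨e, he, rfl⟩, ⟨m, hm, hme⟩, heT⟩ := End.exists_sub_forall_apply_eq_zero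
      (ad K (End K V) '' T)
      (by rintro _ ⟨u, hu, rfl⟩; exact ad_isSemisimple_of_isSemisimple (hTs u hu))
      (by rintro _ ⟨u, hu, rfl⟩ _ ⟨v, hv, rfl⟩; exact commute_ad_of_commute (hTc u hu v hv))
      ((radical K g).toSubmodule.map g.toSubmodule.subtype)
      (n.toSubmodule.map g.toSubmodule.subtype)
      (by
        rintro _ ⟨u, hu, rfl⟩ _ ⟨y, hy, rfl⟩
        exact ⟨⁅(⟨u, hTg hu⟩ : g), y⁆, (radical K g).lie_mem hy, rfl⟩)
      (by
        rintro _ ⟨u, hu, rfl⟩ _ ⟨y, hy, rfl⟩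
        exact ⟨⁅(⟨u, hTg hu⟩ : g), y⁆, hgn _ y hy, rfl⟩)
      (d := (x : End K V)) ⟨x, hx, rfl⟩
    have heT' : ∀ u ∈ T, Commute (e : End K V) u := fun u hu =>
      (commute_iff_lie_eq.mpr (heT _ ⟨u, hu, rfl⟩)).symm
    obtain ⟨a, -, b, hb, hag, hbg, han, hbs, hab, heab⟩ := hg.exists_components e.2
    have hbr : (⟨b, hbg⟩ : g) ∈ radical K g :=
      mem_radical_of_components (n := ⟨a, hag⟩) he han hbs hab heab
    have hbT : b ∈ T := hTmax b hbg hbs fun u hu =>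
      Algebra.commute_of_mem_adjoin_singleton_of_commute hb (heT' u hu).symm
    have hea : e = ⟨a, hag⟩ + ⟨b, hbg⟩ := Subtype.ext heab
    have har : (⟨a, hag⟩ : g) ∈ n := (hn' _).mpr ⟨by
      rw [← add_sub_cancel_right (⟨a, hag⟩ : g) ⟨b, hbg⟩, ← hea]
      exact sub_mem he hbr, han⟩
    refine ⟨⟨b, hbg⟩, hbr, hbT, ?_⟩
    have hmx : m = x - e := Subtype.ext hme
    rw [show x - ⟨b, hbg⟩ = m + ⟨a, hag⟩ by rw [hmx, hea]; abel]
    exact add_mem hm har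
  have hadg : ∀ x ∈ T', (ad K g x).IsSemisimple := fun x hx => by
    have hgx : g.toSubmodule ∈ (ad K (End K V) (x : End K V)).invtSubmodule :=
      fun y hy => g.lie_mem x.2 hy
    exact (ad_isSemisimple_of_isSemisimple (hTs _ hx)).restrict hgx
  obtain ⟨s, hs, hsT⟩ := exists_isCompl_radical_of_isSemisimple T' hTT' hadg
  have hss : HasTrivialRadical K s := hasTrivialRadical_of_isCompl_radical s hs
  have hdisj : ∀ x ∈ s, x ∈ radical K g → x = 0 := fun x hxs hxr =>
    (Submodule.disjoint_def.mp hs.disjoint) x hxs hxr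
  have hsup : ∀ x : g, ∃ y ∈ s, ∃ z ∈ radical K g, y + z = x := fun x =>
    Submodule.mem_sup.mp (hs.sup_eq_top.ge (Submodule.mem_top (x := x)))
  have hus : ∀ u ∈ T', u ∈ radical K g → ∀ w ∈ s, ⁅u, w⁆ = 0 := fun u hu hur w hw =>
    hdisj _ (hsT u hu w hw) (lie_mem_left _ _ _ _ _ hur)
  -- every element of `T` is the sum of elements of `s` and of `T ⊓ radical`
  have hT : ∀ x ∈ T', ∃ y ∈ s, ∃ u ∈ T', u ∈ radical K g ∧ y + u = x := by
    intro x hx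
    obtain ⟨y, hy, z, hz, rfl⟩ := hsup x
    refine ⟨y, hy, z, ?_, hz, rfl⟩
    have hzs : ∀ w ∈ s, ⁅z, w⁆ = 0 := fun w hw => by
      refine hdisj _ ?_ (lie_mem_left _ _ _ _ _ hz)
      have := sub_mem (hsT _ hx w hw) (s.lie_mem hy hw)
      rwa [add_lie, add_sub_cancel_left] at this
    have hyT : ∀ u ∈ T', ⁅u, y⁆ = 0 ∧ ⁅u, z⁆ = 0 := by
      intro u hu
      have h0 := hTT' u hu _ hx
      rw [lie_add] at h0
      have h1 : ⁅u, y⁆ = 0 := by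
        refine hdisj _ (hsT u hu y hy) ?_
        rw [eq_neg_of_add_eq_zero_left h0]
        exact neg_mem ((radical K g).lie_mem hz)
      exact ⟨h1, by rwa [h1, zero_add] at h0⟩
    obtain ⟨a, ha, b, hb, -, -, han, hbs, hab, hyab⟩ := hg.exists_components y.2
    -- On `s` the operator `ad y` coincides with the semisimple `ad (y + z)`, so the nilpotent part
    -- `a` of `y` centralizes `s`.
    have hya : ∀ w ∈ s.toSubmodule.map g.toSubmodule.subtype, ⁅a, w⁆ = 0 := by
      refine End.lie_eq_zero_of_semisimple_restrict (hTs _ hx) han hbs hab ?_ ?_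
      · rintro _ ⟨w, hw, rfl⟩
        exact ⟨⁅y + z, w⁆, hsT _ hx w hw, rfl⟩
      · rintro _ ⟨w, hw, rfl⟩
        have : ⁅y + z, w⁆ = ⁅y, w⁆ := by rw [add_lie, hzs w hw, add_zero]
        rw [← hyab]
        exact congrArg Subtype.val this
    -- Being a polynomial in `y`, which lies in `s`, `a` preserves every `s`-submodule of `V`.
    have ha0 : a = 0 := by
      refine LieModule.eq_zero_of_isNilpotent_of_forall_submodule (L := s) han (fun w v => ?_)
        fun W v hv => ?_
      · have := commute_iff_lie_eq.mpr (hya w ⟨w, w.2, rfl⟩)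
        exact LinearMap.congr_fun this.eq v
      · exact End.apply_mem_of_mem_adjoin ha (p := W.toSubmodule)
          (fun v hv => W.lie_mem (x := ⟨y, hy⟩) hv) v hv
    have hys : (y : End K V).IsSemisimple := by rwa [hyab, ha0, zero_add]
    have hyx : Commute ((y + z : g) : End K V) y :=
      commute_iff_lie_eq.mpr (congrArg Subtype.val (hyT _ hx).1)
    have hzss : (z : End K V).IsSemisimple := by
      have := (hTs _ hx).sub_of_commute hyx hys
      rwa [show ((y + z : g) : End K V) - y = z from add_sub_cancel_left (y : End K V) z] at this
    exact hTmax z z.2 hzss fun u hu =>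
      commute_iff_lie_eq.mpr (congrArg Subtype.val (hyT ⟨u, hTg hu⟩ hu).2)
  -- Only `⁅y, y'⁆` survives in a bracket, since `T ∩ rad g` is commutative and centralizes `s`.
  let l : LieSubalgebra K (End K V) :=
    { carrier := {x | ∃ y ∈ s, ∃ u ∈ T', u ∈ radical K g ∧ ((y + u : g) : End K V) = x}
      zero_mem' := ⟨0, s.zero_mem, 0, T.zero_mem, zero_mem _, by simp⟩
      add_mem' := by
        rintro _ _ ⟨y, hy, u, hu, hur, rfl⟩ ⟨y', hy', u', hu', hur', rfl⟩
        exact ⟨y + y', add_mem hy hy', u + u', T.add_mem hu hu', add_mem hur hur',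
          congrArg Subtype.val (add_add_add_comm y y' u u')⟩
      smul_mem' := by
        rintro c _ ⟨y, hy, u, hu, hur, rfl⟩
        exact ⟨c • y, s.smul_mem c hy, c • u, T.smul_mem c hu,
          (radical K g).toSubmodule.smul_mem c hur, by simp⟩
      lie_mem' := by
        rintro _ _ ⟨y, hy, u, hu, hur, rfl⟩ ⟨y', hy', u', hu', hur', rfl⟩
        refine ⟨⁅y, y'⁆, s.lie_mem hy hy', 0, T.zero_mem, zero_mem _, ?_⟩
        rw [← LieSubalgebra.coe_bracket]
        congr 1
        rw [add_lie, lie_add, lie_add, hus u hu hur y' hy', hTT' u hu u' hu',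
          ← lie_skew y u', hus u' hu' hur' y hy]
        simp }
  have hlg : l ≤ g := by
    rintro _ ⟨y, hy, u, hu, hur, rfl⟩
    exact (y + u).2
  refine ⟨l, ⟨hlg, ?_, n, hn', ?_⟩, fun x hx => ?_⟩
  · refine ⟨fun W => ?_⟩
    have hsl : ∀ y ∈ s, (y : End K V) ∈ l := fun y hy =>
      ⟨y, hy, 0, T.zero_mem, zero_mem _, by rw [add_zero]⟩
    have hul : ∀ u ∈ T', u ∈ radical K g → (u : End K V) ∈ l := fun u hu hur =>
      ⟨0, s.zero_mem, u, hu, hur, by rw [zero_add]⟩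
    obtain ⟨φ, hφW, hφ, hφs, hφu⟩ :=
      LieModule.exists_equivariant_projection_of_hasTrivialRadical (L := s)
      ((fun u : g => (u : End K V)) '' {u | u ∈ T' ∧ u ∈ radical K g})
      (by rintro _ ⟨u, ⟨hu, -⟩, rfl⟩; exact hTs _ hu)
      (by rintro _ ⟨u, ⟨hu, -⟩, rfl⟩ _ ⟨v, ⟨hv, -⟩, rfl⟩; exact hTc _ hu _ hv)
      (by
        rintro _ ⟨u, ⟨hu, hur⟩, rfl⟩ w v
        exact LinearMap.congr_fun
          (commute_iff_lie_eq.mpr (congrArg Subtype.val (hus u hu hur w w.2))).eq v)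
      W.toSubmodule
      (fun w v hv => W.lie_mem (x := ⟨((w : g) : End K V), hsl w w.2⟩) hv)
      (by
        rintro _ ⟨u, ⟨hu, hur⟩, rfl⟩ v hv
        exact W.lie_mem (x := ⟨(u : End K V), hul u hu hur⟩) hv)
    let W' : LieSubmodule K l V := { LinearMap.ker φ with
      lie_mem := by
        rintro ⟨_, y, hy, u, hu, hur, rfl⟩ v (hv : φ v = 0)
        change φ ((y : End K V) v + (u : End K V) v) = 0
        have h1 : φ ((y : End K V) v) = (y : End K V) (φ v) := hφs ⟨y, hy⟩ v
        have h2 : (u : End K V) (φ v) = φ ((u : End K V) v) :=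
          LinearMap.congr_fun (hφu _ ⟨u, ⟨hu, hur⟩, rfl⟩).eq v
        rw [map_add, h1, ← h2, hv, map_zero, map_zero, add_zero] }
    refine ⟨W', ?_⟩
    rw [← LieSubmodule.isCompl_toSubmodule]
    refine ⟨Submodule.disjoint_def.mpr fun v hv (hv' : φ v = 0) => ?_,
      codisjoint_iff.mpr (eq_top_iff.mpr fun v _ => ?_)⟩
    · rw [← hφ v hv, hv']
    · rw [← add_sub_cancel (φ v) v]
      refine Submodule.add_mem_sup (hφW v) (show φ (v - φ v) = 0 from ?_)
      rw [map_sub, hφ _ (hφW v), sub_self]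
  · refine ⟨Submodule.disjoint_def.mpr fun x hx hxn => ?_,
      codisjoint_iff.mpr (eq_top_iff.mpr fun x _ => ?_)⟩
    · obtain ⟨y, hy, u, hu, hur, hx'⟩ := hx
      obtain ⟨hxr, hxnil⟩ := (hn' x).mp hxn
      have hxyu : y + u = x := Subtype.ext hx'
      have hy0 : y = 0 := hdisj y hy (by
        rw [eq_sub_of_add_eq hxyu]
        exact sub_mem hxr hur)
      rw [hy0, zero_add] at hxyu
      subst hxyu
      -- Once the `s`-component is gone, what remains is both nilpotent and semisimple.
      exact Subtype.ext (End.eq_zero_of_isNilpotent_isSemisimple hxnil (hTs _ hu))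
    · obtain ⟨y, hy, r, hr, rfl⟩ := hsup x
      obtain ⟨u, hur, hu, hrn⟩ := hrad r hr
      rw [show y + r = (y + u) + (r - u) by abel]
      exact Submodule.add_mem_sup ⟨y, hy, u, hu, hur, rfl⟩ hrn
  · obtain ⟨y, hy, u, hu, hur, h⟩ := hT ⟨x, htg hx⟩ (htT hx)
    exact ⟨y, hy, u, hu, hur, congrArg Subtype.val h⟩
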